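/- Let $T>0$ and let $X=(X_t)_{t\in[0,T]}$ be an $\mathbb R^d$-valued, continuous, centered Gaussian process with i.i.d. coordinates and $X_0=0$. Write $R(s,t)=\mathbb E[X^j_sX^j_t]$ for the covariance of a coordinate, $\sigma_t^2=R(t,t)$, and, for intervals, $R_{uv}^{st}=\mathbb E[(X^j_t-X^j_s)(X^j_v-X^j_u)]$. For $\rho\ge 1$ put $$\kappa_t^2=V_{1,\rho}(R;[0,t]^2)=\sup_{(t_i),(t_j')}\Big(\sum_j\Big(\sum_i\big|R_{t_it_{i+1}}^{t'_jt'_{j+1}}\big|\Big)^{\rho}\Big)^{1/\rho},$$ the supremum being over all dissections $(t_i),(t'_j)$ of $[0,t]$, and assume $\kappa_T^2<\infty$ for some $\rho\in[1,2)$. Let $\mathcal H$ be the completion of the step functions $\sum_i a_i\mathbf 1_{[0,t_i]}$, $t_i\in[0,T]$, for the inner product determined by $\langle\mathbf 1_{[0,s]},\mathbf 1_{[0,t]}\rangle_{\mathcal H}=R(s,t)$. A function $g:[0,T]\to\mathbb R$ is said to belong to $\mathcal H$ if its tagged step approximations $\sum_i g(\xi_i)\mathbf 1_{(t_i,t_{i+1}]}$,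 $\xi_i\in[t_i,t_{i+1}]$, converge in $\mathcal H$ as the mesh of the dissection $(t_i)$ of $[0,T]$ tends to $0$; the limit is then the element of $\mathcal H$ defined by $g$, and its squared norm $\|g\|_{\mathcal H}^2$ is the two-dimensional Young integral $\int_0^T\!\int_0^T g(s)g(t)\,dR(s,t)$. Let $q=\big(\frac1{2\rho}+\frac12\big)^{-1}$ and let $p\ge1$ satisfy $\frac1p+\frac1q>1$. (i) There is a constant $c>0$, depending only on $p$ and $\rho$, such that for every $f:[0,T]\to\mathbb R$ and every $t\in(0,T]$: if $f\mathbf 1_{[0,t]}$ has finite $p$-variation on $[0,T]$ then $f\mathbf 1_{[0,t]}\in\mathcal H$, and whenever $f\mathbf 1_{[0,t]}\in\mathcal H$, $$\|f\mathbf 1_{[0,t]}\|_{\mathcal H}^2\le c\,\kappa_t^2\big(\|f\mathbf 1_{[0,t]}\|_{p\text{-var};[0,T]}^2+\|f\mathbf 1_{[0,t]}\|_\infty^2\big),$$ where the right-hand side may be infinite (with $0\cdot\infty=0$). (ii) Assume moreover that $R_{t_1t_2}^{t_3t_4}\le0$ (non-positively correlated increments) and $R_{t_2t_3}^{t_1t_4}\ge0$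 (diagonal dominance) for all $0\le t_1<t_2<t_3<t_4\le T$. Let $f:[0,T]\to\mathbb R$ be $\gamma$-Hölder continuous with $\gamma+\frac1\rho>1$, and let $t\in(0,T]$. Then $f\mathbf 1_{[0,t]}\in\mathcal H$, there is a non-negative measure $R(dr,t)$ on $[0,t]$ with $R([u,v],t)=R_{0t}^{uv}$ for all $0\le u\le v\le t$, and $$\|f\mathbf 1_{[0,t]}\|_{\mathcal H}^2\ \ge\ \int_0^t f(r)^2\,R(dr,t)\ \ge\ \sigma_t^2\,\min_{[0,t]}|f|^2 .$$ -/

import Mathlib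

open MeasureTheory ProbabilityTheory Set
open scoped NNReal ENNReal

noncomputable section

/-! ### Dissections and variation -/

/-- A dissection `a = t₀ ≤ t₁ ≤ ⋯ ≤ tₙ = b`. Repeated points are harmless: the corresponding
increments vanish. The values `pt k` for `k > n` play no role. -/
structure Dissection {α : Type*} [Preorder α] (a b : α) where
  n : ℕ
  pt : ℕ → α
  mono : Monotone pt
  first : pt 0 = a
  last : pt n = b

/-- The `p`-variation of a path `f` over all dissections of `[a, b]`. -/
def pVar {α : Type*} [Preorder α] (p : ℝ) (f : α → ℝ) (a b : α) : ℝ≥0∞ :=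
  ⨆ D : Dissection a b,
    (∑ i ∈ Finset.range D.n, ‖f (D.pt (i + 1)) - f (D.pt i)‖ₑ ^ p) ^ (1 / p)

/-- The supremum norm, as an extended nonnegative number. -/
def supNorm {α : Type*} (f : α → ℝ) : ℝ≥0∞ := ⨆ s, ‖f s‖ₑ

/-- The rectangular increment of `R` over `[s, t] × [u, v]`. -/
def rectIncr {α : Type*} (R : Matrix α α ℝ) (s t u v : α) : ℝ :=
  R t v - R t u - R s v + R s u

/-- The mixed `(γ, ρ)`-variation of `R` on `[a, b] × [a', b']`. -/
def mixedVar {α : Type*} [Preorder α] (γ ρ : ℝ) (R : Matrix α α ℝ) (a b a' b' : α) : ℝ≥0∞ :=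
  ⨆ (D : Dissection a b) (D' : Dissection a' b'),
    (∑ j ∈ Finset.range D'.n,
      (∑ i ∈ Finset.range D.n,
        ‖rectIncr R (D.pt i) (D.pt (i + 1)) (D'.pt j) (D'.pt (j + 1))‖ₑ ^ γ) ^ (ρ / γ)) ^ (1 / ρ)

/-! ### The Hilbert space attached to a covariance -/

/-- Step functions `∑ aᵢ 1_{[0, tᵢ]}`, encoded by the finitely supported family of coefficients
`tᵢ ↦ aᵢ` (the encoding is faithful, see `StepFun.toFun_injective`). The second argument is only
there for the semi-inner product below. -/
def StepFun {ι : Type*} (K : Matrix ι ι ℝ) (_hK : K.PosSemidef) : Type _ := ι →₀ ℝ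

namespace StepFun

variable {ι : Type*} {K : Matrix ι ι ℝ} {hK : K.PosSemidef}

instance : AddCommGroup (StepFun K hK) := inferInstanceAs (AddCommGroup (ι →₀ ℝ))

instance : Module ℝ (StepFun K hK) := inferInstanceAs (Module ℝ (ι →₀ ℝ))

/-- The step function `1_{[0, t]}`. -/
def ind (K : Matrix ι ι ℝ) (hK : K.PosSemidef) (t : ι) : StepFun K hK :=
  (Finsupp.single t 1 : ι →₀ ℝ)

/-- The coefficient family. -/
def coeff (a : StepFun K hK) : ι →₀ ℝ := a

/-- The actual function `s ↦ ∑ aᵢ 1_{s ≤ tᵢ}`. -/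
def toFun [LinearOrder ι] (a : StepFun K hK) (s : ι) : ℝ :=
  a.coeff.sum fun t x => x * (Set.Iic t).indicator 1 s

theorem toFun_injective [LinearOrder ι] :
    Function.Injective (toFun : StepFun K hK → ι → ℝ) := by
  have key : ∀ a : ι →₀ ℝ,
      (∀ s, (a.sum fun t x => x * (Set.Iic t).indicator (1 : ι → ℝ) s) = 0) → a = 0 := by
    intro a ha
    by_contra hne
    have hs : a.support.Nonempty := Finsupp.support_nonempty_iff.2 hne
    have hm := ha (a.support.max' hs)
    rw [Finsupp.sum, Finset.sum_eq_single (a.support.max' hs)] at hm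
    · simp at hm
      exact Finsupp.mem_support_iff.1 (a.support.max'_mem hs) hm
    · intro t ht hne'
      have hlt : t < a.support.max' hs := lt_of_le_of_ne (a.support.le_max' t ht) hne'
      rw [Set.indicator_of_notMem (fun h => absurd (Set.mem_Iic.1 h) (not_le.2 hlt)), mul_zero]
    · intro h
      exact absurd (a.support.max'_mem hs) h
  intro a b hab
  refine sub_eq_zero.1 (key (a.coeff - b.coeff) fun s => ?_)
  rw [Finsupp.sum_sub_index (fun t x y => by ring)]
  exact sub_eq_zero.2 (congrFun hab s)

/-- The bilinear form `∑ᵢ ∑ⱼ aᵢ bⱼ K(tᵢ, sⱼ)`. -/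
def form (K : Matrix ι ι ℝ) (a b : ι →₀ ℝ) : ℝ :=
  a.sum fun s x => b.sum fun t y => x * y * K s t

theorem form_comm (hK : K.PosSemidef) (a b : ι →₀ ℝ) : form K b a = form K a b := by
  rw [form, Finsupp.sum_comm]
  refine Finsupp.sum_congr fun s _ => Finsupp.sum_congr fun t _ => ?_
  have := hK.1.apply s t
  simp only [star_trivial] at this
  rw [this]; ring

theorem form_nonneg (hK : K.PosSemidef) (a : ι →₀ ℝ) : 0 ≤ form K a a := by
  have := hK.2 a
  simp only [star_trivial] at this
  refine this.trans_eq ?_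
  refine Finsupp.sum_congr fun s _ => Finsupp.sum_congr fun t _ => ?_
  ring

theorem form_add (a b c : ι →₀ ℝ) : form K (a + b) c = form K a c + form K b c := by
  refine Finsupp.sum_add_index' (fun s => by simp [Finsupp.sum]) (fun s x y => ?_)
  rw [← Finsupp.sum_add]
  exact Finsupp.sum_congr fun t _ => by ring

theorem form_smul (r : ℝ) (a b : ι →₀ ℝ) : form K (r • a) b = r * form K a b := by
  rw [form, Finsupp.sum_smul_index (fun s => by simp [Finsupp.sum]), form, Finsupp.mul_sum]
  refine Finsupp.sum_congr fun s _ => ?_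
  rw [Finsupp.mul_sum]
  exact Finsupp.sum_congr fun t _ => by ring

/-- `⟨∑ aᵢ 1_{[0, tᵢ]}, ∑ bⱼ 1_{[0, sⱼ]}⟩ = ∑ᵢ ∑ⱼ aᵢ bⱼ K(tᵢ, sⱼ)`. -/
instance core : PreInnerProductSpace.Core ℝ (StepFun K hK) where
  inner a b := form K a.coeff b.coeff
  conj_inner_symm a b := form_comm hK a.coeff b.coeff
  re_inner_nonneg a := form_nonneg hK a.coeff
  add_left a b c := form_add a.coeff b.coeff c.coeff
  smul_left a b r := form_smul r a.coeff b.coeff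

instance : SeminormedAddCommGroup (StepFun K hK) :=
  InnerProductSpace.Core.toSeminormedAddCommGroup (𝕜 := ℝ)

instance : InnerProductSpace ℝ (StepFun K hK) := InnerProductSpace.ofCore _

theorem inner_ind (s t : ι) : inner ℝ (ind K hK s) (ind K hK t) = K s t := by
  show form K (Finsupp.single s 1) (Finsupp.single t 1) = K s t
  simp [form]

end StepFun

/-- The Hilbert space `ℋ`: the completion (after identifying elements at distance zero) of the
step functions for the inner product determined by `K`. -/
abbrev WienerSpace {ι : Type*} (K : Matrix ι ι ℝ) (hK : K.PosSemidef) : Type _ :=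
  UniformSpace.Completion (StepFun K hK)

/-- The tagged step approximation `∑ᵢ f(ξᵢ) 1_{(tᵢ, tᵢ₊₁]}` of `f`, as an element of the space of
step functions. -/
def stepApprox {ι : Type*} [Preorder ι] (K : Matrix ι ι ℝ) (hK : K.PosSemidef) (f : ι → ℝ)
    {a b : ι} (D : Dissection a b) (ξ : ℕ → ι) : StepFun K hK :=
  ∑ i ∈ Finset.range D.n,
    f (ξ i) • (StepFun.ind K hK (D.pt (i + 1)) - StepFun.ind K hK (D.pt i))

/-- The function `f` on `[a, b]` belongs to `ℋ`, and `h` is the element of `ℋ` that it defines: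
the step approximations of `f`, with arbitrary tags, converge to `h` in `ℋ` as the mesh of the
dissection tends to zero. In particular `‖h‖²` is the limit of the Riemann sums
`∑ᵢ ∑ⱼ f(ξᵢ) f(ξⱼ) K([tᵢ, tᵢ₊₁] × [tⱼ, tⱼ₊₁])`, i.e. the two-dimensional Young integral of
`f ⊗ f` against `K`; and `⟨h, 1_{[0, s]}⟩` is the Young integral of `f` against `K(·, s)`, up to
the value of `K` at the left end point, which is zero for a process that starts at zero. -/
def Represents {ι : Type*} [LinearOrder ι] [PseudoMetricSpace ι] {K : Matrix ι ι ℝ}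
    {hK : K.PosSemidef} (a b : ι) (f : ι → ℝ) (h : WienerSpace K hK) : Prop :=
  ∀ ε : ℝ, 0 < ε → ∃ δ : ℝ, 0 < δ ∧ ∀ (D : Dissection a b) (ξ : ℕ → ι),
    (∀ i < D.n, D.pt i ≤ ξ i ∧ ξ i ≤ D.pt (i + 1)) →
    (∀ i < D.n, dist (D.pt i) (D.pt (i + 1)) < δ) →
    ‖(stepApprox K hK f D ξ : WienerSpace K hK) - h‖ < ε

/-! ### Gaussian processes -/

/-- `X` is a continuous, centered, `ℝᵈ`-valued Gaussian process with independent and identically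
distributed coordinate processes. -/
structure IsCenteredGaussianIID {Ω : Type*} [MeasurableSpace Ω] {d : ℕ} {ι : Type*}
    [TopologicalSpace ι] (X : ι → Ω → Fin d → ℝ) (P : Measure Ω) : Prop where
  measurable : ∀ t, Measurable (X t)
  gaussian : IsGaussianProcess X P
  centered : ∀ t j, ∫ ω, X t ω j ∂P = 0
  continuous : ∀ᵐ ω ∂P, Continuous fun t => X t ω
  indep : iIndepFun (fun j ω t => X t ω j) P
  identDistrib : ∀ i j, IdentDistrib (fun ω t => X t ω i) (fun ω t => X t ω j) P P

/-- The covariance `R(s, t) = E[X_s^j X_t^j]` of the `j`-th coordinate. -/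
def covKernel {Ω : Type*} [MeasurableSpace Ω] {d : ℕ} {ι : Type*}
    (X : ι → Ω → Fin d → ℝ) (P : Measure Ω) (j : Fin d) : Matrix ι ι ℝ :=
  Matrix.of fun s t => ∫ ω, X s ω j * X t ω j ∂P

/-- The variance `σ_t² = E[(X_t^j)²]`. -/
def sigmaSq {Ω : Type*} [MeasurableSpace Ω] {d : ℕ} {ι : Type*}
    (X : ι → Ω → Fin d → ℝ) (P : Measure Ω) (j : Fin d) (t : ι) : ℝ :=
  ∫ ω, X t ω j ^ 2 ∂P

theorem IsCenteredGaussianIID.memLp {Ω : Type*} [MeasurableSpace Ω] {d : ℕ} {ι : Type*}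
    [TopologicalSpace ι] {X : ι → Ω → Fin d → ℝ} {P : Measure Ω}
    (hX : IsCenteredGaussianIID X P) (t : ι) (j : Fin d) : MemLp (fun ω => X t ω j) 2 P :=
  memLp_pi_iff.1 (hX.gaussian.hasGaussianLaw_eval t).memLp_two j

/-- A covariance is positive semidefinite. -/
theorem IsCenteredGaussianIID.posSemidef {Ω : Type*} [MeasurableSpace Ω] {d : ℕ} {ι : Type*}
    [TopologicalSpace ι] {X : ι → Ω → Fin d → ℝ} {P : Measure Ω}
    (hX : IsCenteredGaussianIID X P) (j : Fin d) : (covKernel X P j).PosSemidef := by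
  refine ⟨?_, fun x => ?_⟩
  · ext s t
    simp [covKernel, mul_comm]
  · have hint : ∀ s t, Integrable (fun ω => X s ω j * X t ω j) P := fun s t =>
      (hX.memLp s j).integrable_mul (hX.memLp t j)
    have : (x.sum fun s a => x.sum fun t b => star a * covKernel X P j s t * b)
        = ∫ ω, (∑ s ∈ x.support, x s * X s ω j) ^ 2 ∂P := by
      simp only [Finsupp.sum, covKernel, Matrix.of_apply, star_trivial, sq, Finset.sum_mul_sum]
      rw [integral_finsetSum]
      · refine Finset.sum_congr rfl fun s _ => ?_
        rw [integral_finsetSum]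
        · refine Finset.sum_congr rfl fun t _ => ?_
          rw [mul_right_comm, ← integral_const_mul]
          congr 1; ext ω; ring
        · intro t _
          exact ((hint s t).const_mul (x s * x t)).congr (ae_of_all _ fun ω => by
            show x s * x t * (X s ω j * X t ω j) = _
            ring)
      · intro s _
        refine integrable_finsetSum _ fun t _ => ?_
        exact ((hint s t).const_mul (x s * x t)).congr (ae_of_all _ fun ω => by
            show x s * x t * (X s ω j * X t ω j) = _
            ring)
    rw [this]
    exact integral_nonneg fun ω => sq_nonneg _

/-- Non-positively correlated increments. -/
def NonposCorrelated {α : Type*} [Preorder α] (R : Matrix α α ℝ) : Prop :=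
  ∀ t₁ t₂ t₃ t₄ : α, t₁ < t₂ → t₂ < t₃ → t₃ < t₄ → rectIncr R t₁ t₂ t₃ t₄ ≤ 0

/-- Diagonal dominance. -/
def DiagDominant {α : Type*} [Preorder α] (R : Matrix α α ℝ) : Prop :=
  ∀ t₁ t₂ t₃ t₄ : α, t₁ < t₂ → t₂ < t₃ → t₃ < t₄ → 0 ≤ rectIncr R t₂ t₃ t₁ t₄

/-- `ν` is the measure `R(dr, t)` on `[a, t]`, i.e. the (unique) non-negative measure with
`ν [u, v] = R([u, v] × [a, t])` for all `a ≤ u ≤ v ≤ t`, and no mass outside `[a, t]`. -/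
def IsIncrMeasure {α : Type*} [Preorder α] [MeasurableSpace α] (R : Matrix α α ℝ) (a t : α)
    (ν : Measure α) : Prop :=
  (∀ u v, a ≤ u → u ≤ v → v ≤ t →
    0 ≤ rectIncr R u v a t ∧ ν (Icc u v) = ENNReal.ofReal (rectIncr R u v a t)) ∧
  ν (Icc a t)ᶜ = 0

end

/-!
Write `φ s` for the element `1_{[0, s]}` of the space of step functions, so that
`⟪φ t - φ s, φ v - φ u⟫` is the rectangular increment of the covariance `R`.

*Upper bound.* For `h` in the space of step functions, the path `H s = ⟪h, φ s⟫` has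
`q`-variation at most `‖h‖ κ` (`StepFun.variationLE_inner`): the `q`-th powers of its increments
sum up to `⟪h, y⟫` for a step function `y`, whose norm is estimated by `2 β β' |R| ≤ (β² + β'²) |R|`
and Hölder's inequality. As `1 / p + 1 / q > 1`, Young's inequality (`young_sum_le`) bounds every
Riemann sum of a function of finite `p`-variation against `H`. Applied to the path of a step
approximation `h` of `f` itself, whose Riemann sum is `‖h‖²`, this bounds `‖h‖`
(`StepFun.norm_sum_le`), without any two-dimensional integration.

*Convergence of the step approximations.* A step approximation along `D` is compared with one along
a refinement of `D` (`StepFun.norm_refinement_sub_stepApprox_le`). Their difference, paired with a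
step function `h`, is a Riemann sum against `H - H ∘ π`, where `π` projects to the points of `D`, up
to a difference of two Riemann sums along `D`. Both are small: for `q' > q` the `q'`-variation is
bounded by the `q`-variation and a positive power of the oscillation, and the oscillation of `H`
on intervals of small length is small uniformly over `‖h‖ ≤ 1`, because `φ` is continuous
(`IsCenteredGaussianIID.continuous_ind`). Jumps of `f` do not matter, as `q'` can still be taken
with `1 / p + 1 / q' > 1`.

*Lower bound.* If the increments over disjoint intervals are non-positively correlated, then
`fᵢ fⱼ Rᵢⱼ ≥ (fᵢ² + fⱼ²) / 2 * Rᵢⱼ` for all `i`, `j`, so that the squared norm of a step approximation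
over `[0, t]` is at least `∑ fⱼ² R([tⱼ, tⱼ₊₁] × [0, t])` (`sum_sq_mul_inner_sum_le`). By diagonal
dominance this is a Riemann sum for a Stieltjes measure (`exists_isIncrMeasure`), and with tags that
maximize `f²` it is at least the integral of `f²`.
-/

/-! ### Paths of finite variation and Young's inequality -/

/-- The path `f` has `p`-variation at most `A` along points of `S`: every sum of `p`-th powers of
increments along a monotone sequence in `S` is at most `A ^ p`. The bound is a real number, and the
sequences need not start or end at prescribed points, so that the notion is stable under monotone
reparametrization. -/
def VariationLE {α : Type*} [Preorder α] (p A : ℝ) (f : α → ℝ) (S : Set α) : Prop :=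
  ∀ x : ℕ → α, Monotone x → (∀ k, x k ∈ S) → ∀ m : ℕ,
    ∑ i ∈ Finset.range m, |f (x (i + 1)) - f (x i)| ^ p ≤ A ^ p

namespace VariationLE

variable {α β : Type*} [Preorder α] [Preorder β] {p q A B : ℝ} {f g : α → ℝ} {S : Set α}

theorem comp (hf : VariationLE p A f S) {φ : β → α} (hφ : Monotone φ) {U : Set β}
    (hU : ∀ s ∈ U, φ s ∈ S) : VariationLE p A (fun s => f (φ s)) U :=
  fun x hx hxU m => hf (fun k => φ (x k)) (hφ.comp hx) (fun k => hU _ (hxU k)) m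

theorem mono_set (hf : VariationLE p A f S) {U : Set α} (hU : U ⊆ S) : VariationLE p A f U :=
  fun x hx hxU m => hf x hx (fun k => hU (hxU k)) m

theorem abs_sub_le (hf : VariationLE p A f S) (hp : 0 < p) (hA : 0 ≤ A) {u v : α} (huv : u ≤ v)
    (hu : u ∈ S) (hv : v ∈ S) : |f v - f u| ≤ A := by
  have h := hf (fun k => if k = 0 then u else v) (by
    refine monotone_nat_of_le_succ fun k => ?_
    by_cases hk : k = 0 <;> simp [hk, huv]) (fun k => by by_cases hk : k = 0 <;> simp [hk, hu, hv]) 1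
  simp only [Finset.range_one, Finset.sum_singleton, zero_add, one_ne_zero, if_false,
    if_true] at h
  exact (Real.rpow_le_rpow_iff (abs_nonneg _) hA hp).1 h

/-- Increments over consecutive, not necessarily adjacent, intervals `[u i, v i]`. -/
theorem sum_le_of_disjoint (hf : VariationLE p A f S) {u v : ℕ → α} (huv : ∀ i, u i ≤ v i)
    (hvu : ∀ i, v i ≤ u (i + 1)) (hu : ∀ i, u i ∈ S) (hv : ∀ i, v i ∈ S) (n : ℕ) :
    ∑ i ∈ Finset.range n, |f (v i) - f (u i)| ^ p ≤ A ^ p := by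
  set x : ℕ → α := fun k => if k % 2 = 0 then u (k / 2) else v (k / 2) with hx
  have hx0 : ∀ i, x (2 * i) = u i := fun i => by simp [hx]
  have hx1 : ∀ i, x (2 * i + 1) = v i := fun i => by
    have h1 : (2 * i + 1) % 2 = 1 := by omega
    have h2 : (2 * i + 1) / 2 = i := by omega
    simp [hx, h2]
  have hmono : Monotone x := by
    refine monotone_nat_of_le_succ fun k => ?_
    obtain ⟨i, rfl | rfl⟩ : ∃ i, k = 2 * i ∨ k = 2 * i + 1 := ⟨k / 2, by omega⟩
    · rw [hx0, hx1]; exact huv i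
    · rw [hx1, show 2 * i + 1 + 1 = 2 * (i + 1) by ring, hx0]; exact hvu i
  have hmem : ∀ k, x k ∈ S := fun k => by
    by_cases hk : k % 2 = 0 <;> simp [hx, hk, hu, hv]
  refine le_trans ?_ (hf x hmono hmem (2 * n))
  have : ∀ n : ℕ, ∑ i ∈ Finset.range n, |f (v i) - f (u i)| ^ p ≤
      ∑ i ∈ Finset.range (2 * n), |f (x (i + 1)) - f (x i)| ^ p := by
    intro n
    induction n with
    | zero => simp
    | succ n ih =>
      rw [Finset.sum_range_succ, show 2 * (n + 1) = 2 * n + 1 + 1 by ring, Finset.sum_range_succ,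
        Finset.sum_range_succ, hx1, hx0]
      have : 0 ≤ |f (x (2 * n + 1 + 1)) - f (v n)| ^ p := by positivity
      linarith
  exact this n

/-- The constant `4` is convenient rather than sharp. -/
theorem sub (hf : VariationLE q B f S) (hg : VariationLE q B g S) (hq : 1 ≤ q) (hB : 0 ≤ B) :
    VariationLE q (4 * B) (fun s => f s - g s) S := by
  intro x hx hxS m
  have key : ∀ y z : ℝ, |y - z| ^ q ≤ 2 ^ q * (|y| ^ q + |z| ^ q) := by
    intro y z
    have h1 : |y - z| ≤ 2 * max |y| |z| := by
      have := abs_sub y z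
      linarith [le_max_left |y| |z|, le_max_right |y| |z|]
    refine (Real.rpow_le_rpow (abs_nonneg _) h1 (by linarith)).trans ?_
    rw [Real.mul_rpow (by norm_num) (by positivity)]
    refine mul_le_mul_of_nonneg_left ?_ (by positivity)
    have hy : 0 ≤ |y| ^ q := by positivity
    have hz : 0 ≤ |z| ^ q := by positivity
    rcases max_cases |y| |z| with ⟨h, _⟩ | ⟨h, _⟩ <;> rw [h] <;> linarith
  calc ∑ i ∈ Finset.range m, |f (x (i + 1)) - g (x (i + 1)) - (f (x i) - g (x i))| ^ q
      ≤ ∑ i ∈ Finset.range m, 2 ^ q * (|f (x (i + 1)) - f (x i)| ^ q +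
          |g (x (i + 1)) - g (x i)| ^ q) := by
        refine Finset.sum_le_sum fun i _ => ?_
        rw [sub_sub_sub_comm]
        exact key _ _
    _ ≤ 2 ^ q * (B ^ q + B ^ q) := by
        rw [← Finset.mul_sum, Finset.sum_add_distrib]
        exact mul_le_mul_of_nonneg_left (add_le_add (hf x hx hxS m) (hg x hx hxS m)) (by positivity)
    _ ≤ (4 * B) ^ q := by
        rw [show (4 : ℝ) * B = 2 * (2 * B) by ring, Real.mul_rpow (by norm_num) (by positivity),
          Real.mul_rpow (by norm_num) hB]
        refine mul_le_mul_of_nonneg_left ?_ (by positivity)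
        have h2 : (2 : ℝ) ≤ 2 ^ q := Real.self_le_rpow_of_one_le (by norm_num) hq
        have : 0 ≤ B ^ q := by positivity
        nlinarith

/-- Monotonicity in the bound. -/
theorem mono_bound (hf : VariationLE p A f S) (hp : 0 ≤ p) (hA : 0 ≤ A) (hAB : A ≤ B) :
    VariationLE p B f S :=
  fun x hx hxS m => (hf x hx hxS m).trans (Real.rpow_le_rpow hA hAB hp)

end VariationLE

/-- Interpolation between `ℓ^q` and `ℓ^∞`. -/
theorem sum_rpow_le_of_abs_le {q q' B w : ℝ} (hB : 0 ≤ B) (hq : 0 < q) (hqq : q < q')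
    (hw : 0 ≤ w) {m : ℕ} {d : ℕ → ℝ} (hd : ∀ i < m, |d i| ≤ w)
    (hs : ∑ i ∈ Finset.range m, |d i| ^ q ≤ B ^ q) :
    ∑ i ∈ Finset.range m, |d i| ^ q' ≤ (w ^ (1 - q / q') * B ^ (q / q')) ^ q' := by
  have hq' : 0 < q' := hq.trans hqq
  have key : ∀ i ∈ Finset.range m, |d i| ^ q' ≤ w ^ (q' - q) * |d i| ^ q := by
    intro i hi
    rcases (abs_nonneg (d i)).eq_or_lt with h | h
    · rw [← h, Real.zero_rpow hq'.ne', Real.zero_rpow hq.ne', mul_zero]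
    · calc |d i| ^ q' = |d i| ^ (q' - q) * |d i| ^ q := by
            rw [← Real.rpow_add h]; ring_nf
        _ ≤ _ := by
            refine mul_le_mul_of_nonneg_right ?_ (by positivity)
            exact Real.rpow_le_rpow h.le (hd i (Finset.mem_range.1 hi)) (by linarith)
  calc ∑ i ∈ Finset.range m, |d i| ^ q'
      ≤ w ^ (q' - q) * B ^ q := by
        refine (Finset.sum_le_sum key).trans ?_
        rw [← Finset.mul_sum]
        exact mul_le_mul_of_nonneg_left hs (by positivity)
    _ = _ := by
        rw [Real.mul_rpow (by positivity) (by positivity), ← Real.rpow_mul hw, ← Real.rpow_mul hB]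
        congr 2 <;> field_simp

/-- A path of finite `q`-variation and small oscillation `w` has small `q'`-variation, `q < q'`. -/
theorem VariationLE.interpolate {α : Type*} [Preorder α] {q q' B w : ℝ} {f : α → ℝ} {S : Set α}
    (hf : VariationLE q B f S) (hB : 0 ≤ B) (hq : 0 < q) (hqq : q < q') (hw : 0 ≤ w)
    (hosc : ∀ s ∈ S, ∀ t ∈ S, |f t - f s| ≤ w) :
    VariationLE q' (w ^ (1 - q / q') * B ^ (q / q')) f S :=
  fun x hx hxS m => sum_rpow_le_of_abs_le hB hq hqq hw
    (fun _ _ => hosc _ (hxS _) _ (hxS _)) (hf x hx hxS m)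

/-- Hölder's inequality with `1 / p + 1 / q ≥ 1`, for bounds `A`, `B` on the `ℓᵖ` and `ℓ^q` norms:
with `θ = 1 / p + 1 / q`, the product is bounded in `ℓ^(1 / θ)`. -/
theorem sum_mul_rpow_le {p q θ A B : ℝ} (hp : 0 < p) (hq : 0 < q) (hθ : θ = 1 / p + 1 / q)
    (hA : 0 ≤ A) (hB : 0 ≤ B) {n : ℕ} {u v : ℕ → ℝ}
    (hu : ∑ i ∈ Finset.range n, |u i| ^ p ≤ A ^ p)
    (hv : ∑ i ∈ Finset.range n, |v i| ^ q ≤ B ^ q) :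
    ∑ i ∈ Finset.range n, |u i * v i| ^ (1 / θ) ≤ (A * B) ^ (1 / θ) := by
  have hθ0 : 0 < θ := by rw [hθ]; positivity
  have htriple : Real.HolderTriple p q (1 / θ) := by
    refine ⟨?_, hp, hq⟩
    rw [hθ]; simp
  refine (Real.Lr_rpow_le_Lp_mul_Lq _ u v htriple).trans ?_
  rw [Real.mul_rpow hA hB]
  refine mul_le_mul ?_ ?_ (by positivity) (by positivity)
  · refine (Real.rpow_le_rpow (by positivity) hu (by positivity)).trans_eq ?_
    rw [← Real.rpow_mul hA]; congr 1; field_simp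
  · refine (Real.rpow_le_rpow (by positivity) hv (by positivity)).trans_eq ?_
    rw [← Real.rpow_mul hB]; congr 1; field_simp

/-- Hölder's inequality with `1 / p + 1 / q ≥ 1`. -/
theorem sum_mul_le_of_one_le {p q A B : ℝ} (hp : 0 < p) (hq : 0 < q) (hpq : 1 ≤ 1 / p + 1 / q)
    (hA : 0 ≤ A) (hB : 0 ≤ B) {n : ℕ} {u v : ℕ → ℝ}
    (hu : ∑ i ∈ Finset.range n, |u i| ^ p ≤ A ^ p)
    (hv : ∑ i ∈ Finset.range n, |v i| ^ q ≤ B ^ q) :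
    ∑ i ∈ Finset.range n, |u i * v i| ≤ A * B := by
  have h := sum_mul_rpow_le hp hq rfl hA hB hu hv
  set r := 1 / (1 / p + 1 / q) with hr
  have hr0 : 0 < r := by positivity
  have hr1 : r ≤ 1 := by rw [hr, div_le_one (by positivity)]; exact hpq
  have hAB : 0 ≤ A * B := mul_nonneg hA hB
  -- each term is at most `A * B`, so that `w ≤ w ^ r * (A * B) ^ (1 - r)`
  have key : ∀ i ∈ Finset.range n, |u i * v i| ≤ |u i * v i| ^ r * (A * B) ^ (1 - r) := by
    intro i hi
    have h1 : |u i * v i| ^ r ≤ (A * B) ^ r :=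
      (Finset.single_le_sum (f := fun i => |u i * v i| ^ r) (fun _ _ => by positivity) hi).trans h
    have h2 : |u i * v i| ≤ A * B := (Real.rpow_le_rpow_iff (abs_nonneg _) hAB hr0).1 h1
    rcases (abs_nonneg (u i * v i)).eq_or_lt with h0 | h0
    · rw [← h0, Real.zero_rpow hr0.ne', zero_mul]
    · calc |u i * v i| = |u i * v i| ^ r * |u i * v i| ^ (1 - r) := by
            rw [← Real.rpow_add h0]; simp
        _ ≤ _ := by
            refine mul_le_mul_of_nonneg_left ?_ (by positivity)
            exact Real.rpow_le_rpow h0.le h2 (by linarith)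
  refine (Finset.sum_le_sum key).trans ?_
  rw [← Finset.sum_mul]
  refine (mul_le_mul_of_nonneg_right h (by positivity)).trans_eq ?_
  rw [← Real.rpow_add' hAB (by simp)]; simp

/-- Removing the point `j + 1` from a Riemann sum changes it by a product of two increments. -/
theorem sum_removePoint (a b : ℕ → ℝ) (j n : ℕ) (hj : j < n) :
    ∑ i ∈ Finset.range (n + 1), a i * (b (i + 1) - b i) =
      ∑ i ∈ Finset.range n, a (if i ≤ j then i else i + 1) *
        (b (if i + 1 ≤ j then i + 1 else i + 1 + 1) - b (if i ≤ j then i else i + 1)) +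
      (a (j + 1) - a j) * (b (j + 2) - b (j + 1)) := by
  obtain ⟨m, rfl⟩ : ∃ m, n = j + 1 + m := ⟨n - (j + 1), by omega⟩
  induction m with
  | zero =>
    rw [add_zero, Finset.sum_range_succ, Finset.sum_range_succ, Finset.sum_range_succ]
    have : ∑ i ∈ Finset.range j, a (if i ≤ j then i else i + 1) *
        (b (if i + 1 ≤ j then i + 1 else i + 1 + 1) - b (if i ≤ j then i else i + 1)) =
        ∑ i ∈ Finset.range j, a i * (b (i + 1) - b i) := by
      refine Finset.sum_congr rfl fun i hi => ?_
      have hi' := Finset.mem_range.1 hi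
      rw [if_pos hi'.le, if_pos (by omega)]
    rw [this, if_pos le_rfl, if_neg (by omega)]
    ring
  | succ m ih =>
    rw [Finset.sum_range_succ, show j + 1 + (m + 1) = j + 1 + m + 1 by ring, ih (by omega),
      Finset.sum_range_succ _ (j + 1 + m), if_neg (by omega), if_neg (by omega)]
    ring

/-- Young's inequality for sums that are normalized at the first point, by induction on the number of
points: the point that matters least is removed. -/
theorem young_sub_first {p q A B : ℝ} (hp : 0 < p) (hq : 0 < q) (hA : 0 ≤ A) (hB : 0 ≤ B) (n : ℕ) :
    ∀ a b : ℕ → ℝ, VariationLE p A a univ → VariationLE q B b univ →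
      |∑ i ∈ Finset.range n, (a i - a 0) * (b (i + 1) - b i)| ≤
        A * B * ∑ k ∈ Finset.range n, 1 / (k : ℝ) ^ (1 / p + 1 / q) := by
  induction n with
  | zero => intro a b _ _; simp
  | succ n ih =>
    intro a b ha hb
    rcases Nat.eq_zero_or_pos n with rfl | hn
    · simp only [zero_add, Finset.range_one, Finset.sum_singleton, sub_self, zero_mul, abs_zero]
      positivity
    set θ := 1 / p + 1 / q with hθ
    have hθ0 : 0 < θ := by positivity
    have hn' : (0 : ℝ) < n := by exact_mod_cast hn
    -- the smallest of the `n` products of increments is at most their mean in `ℓ^(1 / θ)`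
    obtain ⟨j, hj, hjle⟩ : ∃ j < n,
        |(a (j + 1) - a j) * (b (j + 2) - b (j + 1))| ≤ A * B * (1 / (n : ℝ) ^ θ) := by
      by_contra! hcon
      have h := sum_mul_rpow_le (u := fun i => a (i + 1) - a i) (v := fun i => b (i + 2) - b (i + 1))
        (n := n) hp hq hθ hA hB
        (ha (fun k => k) monotone_id (fun _ => mem_univ _) n)
        (hb (fun k => k + 1) (fun _ _ h => Nat.succ_le_succ h) (fun _ => mem_univ _) n)
      have h2 : ∑ _i ∈ Finset.range n, (A * B * (1 / (n : ℝ) ^ θ)) ^ (1 / θ) <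
          ∑ i ∈ Finset.range n, |(a (i + 1) - a i) * (b (i + 2) - b (i + 1))| ^ (1 / θ) := by
        refine Finset.sum_lt_sum_of_nonempty ⟨0, by simpa using hn⟩ fun i hi => ?_
        exact Real.rpow_lt_rpow (by positivity) (hcon i (Finset.mem_range.1 hi)) (by positivity)
      have h3 : ∑ _i ∈ Finset.range n, (A * B * (1 / (n : ℝ) ^ θ)) ^ (1 / θ) =
          (A * B) ^ (1 / θ) := by
        rw [Finset.sum_const, Finset.card_range, nsmul_eq_mul,
          Real.mul_rpow (by positivity) (by positivity), Real.div_rpow (by positivity)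
          (by positivity), Real.one_rpow, ← Real.rpow_mul hn'.le, mul_one_div_cancel hθ0.ne',
          Real.rpow_one]
        field_simp
      linarith
    have hmono : Monotone fun i : ℕ => if i ≤ j then i else i + 1 := by
      intro i k hik
      show (if i ≤ j then i else i + 1) ≤ (if k ≤ j then k else k + 1)
      split_ifs <;> omega
    have hrec := ih (fun i => a (if i ≤ j then i else i + 1))
      (fun i => b (if i ≤ j then i else i + 1))
      (ha.comp hmono fun _ _ => mem_univ _) (hb.comp hmono fun _ _ => mem_univ _)
    have hrem := sum_removePoint (fun i => a i - a 0) b j n hj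
    simp only [sub_sub_sub_cancel_right] at hrem
    simp only [zero_le, if_true] at hrec
    rw [hrem, Finset.sum_range_succ, mul_add]
    exact (abs_add_le _ _).trans (add_le_add hrec hjle)

/-- The constant in Young's inequality. The term `k = 0` is `0`. -/
noncomputable def youngConst (θ : ℝ) : ℝ := ∑' k : ℕ, 1 / (k : ℝ) ^ θ

theorem youngConst_nonneg (θ : ℝ) : 0 ≤ youngConst θ := tsum_nonneg fun _ => by positivity

/-- Young's inequality for Riemann sums. -/
theorem young_sum_le {p q A B M : ℝ} (hp : 0 < p) (hq : 0 < q) (hpq : 1 < 1 / p + 1 / q)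
    (hA : 0 ≤ A) (hB : 0 ≤ B) {a b : ℕ → ℝ} (ha : VariationLE p A a univ)
    (hb : VariationLE q B b univ) (hM : |a 0| ≤ M) (n : ℕ) :
    |∑ i ∈ Finset.range n, a i * (b (i + 1) - b i)| ≤
      (M + youngConst (1 / p + 1 / q) * A) * B := by
  have h1 := young_sub_first hp hq hA hB n a b ha hb
  have h2 : ∑ k ∈ Finset.range n, 1 / (k : ℝ) ^ (1 / p + 1 / q) ≤ youngConst (1 / p + 1 / q) :=
    (Real.summable_one_div_nat_rpow.2 hpq).sum_le_tsum _ fun _ _ => by positivity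
  have h3 : ∑ i ∈ Finset.range n, a i * (b (i + 1) - b i) =
      ∑ i ∈ Finset.range n, (a i - a 0) * (b (i + 1) - b i) + a 0 * (b n - b 0) := by
    rw [← Finset.sum_range_sub b n, Finset.mul_sum, ← Finset.sum_add_distrib]
    exact Finset.sum_congr rfl fun i _ => by ring
  have h4 : |b n - b 0| ≤ B := hb.abs_sub_le hq hB (Nat.zero_le n) (mem_univ _) (mem_univ _)
  have h5 : |a 0 * (b n - b 0)| ≤ M * B := by
    rw [abs_mul]; exact mul_le_mul hM h4 (abs_nonneg _) ((abs_nonneg _).trans hM)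
  have h6 := mul_le_mul_of_nonneg_left h2 (mul_nonneg hA hB)
  rw [h3]
  refine (abs_add_le _ _).trans ?_
  linarith

/-! ### From suprema over dissections to monotone sequences -/

/-- Along monotone sequences in `S`, the mixed `(1, ρ)`-variation of `K` is at most `V`. -/
def MixedVariationLE {ι : Type*} [Preorder ι] (ρ V : ℝ) (K : Matrix ι ι ℝ) (S : Set ι) : Prop :=
  ∀ x : ℕ → ι, Monotone x → (∀ k, x k ∈ S) → ∀ m : ℕ,
    ∑ j ∈ Finset.range m, (∑ i ∈ Finset.range m,
      |rectIncr K (x i) (x (i + 1)) (x j) (x (j + 1))|) ^ ρ ≤ V ^ ρ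

namespace Dissection

variable {α : Type*} [Preorder α] {a b : α}

theorem pt_mem (D : Dissection a b) {i : ℕ} (hi : i ≤ D.n) : D.pt i ∈ Icc a b :=
  ⟨D.first.symm.trans_le (D.mono (Nat.zero_le i)), (D.mono hi).trans_eq D.last⟩

/-- Any monotone sequence in `[a, b]` is part of a dissection of `[a, b]`. -/
theorem exists_extending {x : ℕ → α} (hx : Monotone x) (hmem : ∀ k, x k ∈ Icc a b) (m : ℕ) :
    ∃ D : Dissection a b, D.n = m + 2 ∧ ∀ i ≤ m, D.pt (i + 1) = x i := by
  refine ⟨⟨m + 2, fun k => if k = 0 then a else if k ≤ m + 1 then x (k - 1) else b, ?_, ?_, ?_⟩,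
    rfl, ?_⟩
  · refine monotone_nat_of_le_succ fun k => ?_
    rcases Nat.eq_zero_or_pos k with rfl | hk
    · simpa using (hmem 0).1
    · rw [if_neg hk.ne', if_neg (Nat.succ_ne_zero k)]
      by_cases h1 : k + 1 ≤ m + 1
      · rw [if_pos (by omega), if_pos h1]; exact hx (by omega)
      · rw [if_neg h1]
        split_ifs
        · exact (hmem _).2
        · exact le_rfl
  · simp
  · simp
  · intro i hi
    simp [hi]

/-- Prolonging a dissection of `[a, b]` to one of `[a, c]` by the point `c`. -/
def extend (D : Dissection a b) {c : α} (hbc : b ≤ c) : Dissection a c where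
  n := D.n + 1
  pt k := if k ≤ D.n then D.pt k else c
  mono := by
    refine monotone_nat_of_le_succ fun k => ?_
    by_cases h1 : k + 1 ≤ D.n
    · rw [if_pos (by omega), if_pos h1]; exact D.mono (Nat.le_succ k)
    · rw [if_neg h1]
      split_ifs with h
      · exact ((D.mono h).trans_eq D.last).trans hbc
      · exact le_rfl
  first := by simp [D.first]
  last := by simp

theorem extend_pt (D : Dissection a b) {c : α} (hbc : b ≤ c) {k : ℕ} (hk : k ≤ D.n) :
    (D.extend hbc).pt k = D.pt k := if_pos hk

end Dissection

theorem mixedVar_mono {α : Type*} [Preorder α] {γ ρ : ℝ} (hγ : 0 ≤ γ) (hρ : 0 ≤ ρ)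
    (R : Matrix α α ℝ) {a b c : α} (hbc : b ≤ c) :
    mixedVar γ ρ R a b a b ≤ mixedVar γ ρ R a c a c := by
  refine iSup₂_le fun D D' => le_iSup₂_of_le (D.extend hbc) (D'.extend hbc) ?_
  refine ENNReal.rpow_le_rpow ?_ (by positivity)
  refine le_trans ?_ (Finset.sum_le_sum_of_subset (Finset.range_subset_range.2 (Nat.le_succ D'.n)))
  refine Finset.sum_le_sum fun j hj => ?_
  have hj' := Finset.mem_range.1 hj
  refine ENNReal.rpow_le_rpow ?_ (by positivity)
  refine le_trans ?_ (Finset.sum_le_sum_of_subset (Finset.range_subset_range.2 (Nat.le_succ D.n)))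
  refine Finset.sum_le_sum fun i hi => ?_
  have hi' := Finset.mem_range.1 hi
  rw [D.extend_pt hbc hi'.le, D.extend_pt hbc hi', D'.extend_pt hbc hj'.le, D'.extend_pt hbc hj']

theorem le_toReal_rpow_of_ofReal_rpow_le {p s : ℝ} (hp : 0 < p) (hs : 0 ≤ s) {P : ℝ≥0∞}
    (hP : P ≠ ∞) (h : ENNReal.ofReal s ^ (1 / p) ≤ P) : s ≤ P.toReal ^ p := by
  rw [ENNReal.ofReal_rpow_of_nonneg hs (by positivity)] at h
  have h1 := (ENNReal.ofReal_le_iff_le_toReal hP).1 h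
  calc s = (s ^ (1 / p)) ^ p := by
        rw [← Real.rpow_mul hs, one_div_mul_cancel hp.ne', Real.rpow_one]
    _ ≤ _ := Real.rpow_le_rpow (by positivity) h1 hp.le

theorem enorm_rpow_eq_ofReal {p : ℝ} (hp : 0 ≤ p) (x : ℝ) :
    ‖x‖ₑ ^ p = ENNReal.ofReal (|x| ^ p) := by
  rw [Real.enorm_eq_ofReal_abs, ENNReal.ofReal_rpow_of_nonneg (abs_nonneg _) hp]

theorem variationLE_of_pVar_ne_top {α : Type*} [Preorder α] {p : ℝ} (hp : 0 < p) {f : α → ℝ}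
    {a b : α} (hf : pVar p f a b ≠ ∞) : VariationLE p (pVar p f a b).toReal f (Icc a b) := by
  intro x hx hmem m
  obtain ⟨D, hn, hD⟩ := Dissection.exists_extending hx hmem m
  have h := le_iSup (fun D : Dissection a b =>
    (∑ i ∈ Finset.range D.n, ‖f (D.pt (i + 1)) - f (D.pt i)‖ₑ ^ p) ^ (1 / p)) D
  simp only [enorm_rpow_eq_ofReal hp.le] at h
  rw [← ENNReal.ofReal_sum_of_nonneg (fun _ _ => by positivity)] at h
  have h2 := le_toReal_rpow_of_ofReal_rpow_le hp (by positivity) hf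
    (h.trans_eq (by simp only [pVar, enorm_rpow_eq_ofReal hp.le]))
  refine le_trans ?_ h2
  rw [hn, Finset.sum_range_succ']
  refine le_trans ?_ (le_add_of_nonneg_right (by positivity))
  rw [Finset.sum_range_succ]
  refine le_trans (le_of_eq ?_) (le_add_of_nonneg_right (by positivity))
  refine Finset.sum_congr rfl fun i hi => ?_
  have hi' := Finset.mem_range.1 hi
  rw [hD i hi'.le, hD (i + 1) hi']

theorem mixedVariationLE_of_ne_top {α : Type*} [Preorder α] {ρ : ℝ} (hρ : 0 < ρ)
    {K : Matrix α α ℝ} {a b : α} (hK : mixedVar 1 ρ K a b a b ≠ ∞) :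
    MixedVariationLE ρ (mixedVar 1 ρ K a b a b).toReal K (Icc a b) := by
  intro x hx hmem m
  obtain ⟨D, hn, hD⟩ := Dissection.exists_extending hx hmem m
  have h : (∑ j ∈ Finset.range D.n,
      (∑ i ∈ Finset.range D.n,
        ‖rectIncr K (D.pt i) (D.pt (i + 1)) (D.pt j) (D.pt (j + 1))‖ₑ ^ (1 : ℝ)) ^ (ρ / 1)) ^ (1 / ρ)
      ≤ mixedVar 1 ρ K a b a b :=
    le_iSup₂ (f := fun D D' : Dissection a b => (∑ j ∈ Finset.range D'.n,
      (∑ i ∈ Finset.range D.n,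
        ‖rectIncr K (D.pt i) (D.pt (i + 1)) (D'.pt j) (D'.pt (j + 1))‖ₑ ^ (1 : ℝ)) ^ (ρ / 1)) ^
          (1 / ρ)) D D
  have e1 : ∀ j, (∑ i ∈ Finset.range D.n,
      ‖rectIncr K (D.pt i) (D.pt (i + 1)) (D.pt j) (D.pt (j + 1))‖ₑ ^ (1 : ℝ)) ^ (ρ / 1) =
      ENNReal.ofReal ((∑ i ∈ Finset.range D.n,
        |rectIncr K (D.pt i) (D.pt (i + 1)) (D.pt j) (D.pt (j + 1))|) ^ ρ) := by
    intro j
    simp only [enorm_rpow_eq_ofReal zero_le_one, Real.rpow_one, div_one]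
    rw [← ENNReal.ofReal_sum_of_nonneg (fun _ _ => abs_nonneg _),
      ENNReal.ofReal_rpow_of_nonneg (by positivity) hρ.le]
  simp only [e1] at h
  rw [← ENNReal.ofReal_sum_of_nonneg (fun _ _ => by positivity)] at h
  refine le_trans ?_ (le_toReal_rpow_of_ofReal_rpow_le hρ (by positivity) hK h)
  -- the sums along `x` are sums over the inner indices `1, …, m` of those along `D`
  have shrink : ∀ F : ℕ → ℝ, (∀ i, 0 ≤ F i) →
      ∑ i ∈ Finset.range m, F (i + 1) ≤ ∑ i ∈ Finset.range (m + 2), F i := by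
    intro F hF
    rw [Finset.sum_range_succ', Finset.sum_range_succ]
    linarith [hF 0, hF (m + 1)]
  rw [hn]
  refine le_trans (Finset.sum_le_sum fun j hj => ?_) (shrink _ fun j => by positivity)
  refine Real.rpow_le_rpow (by positivity) ?_ hρ.le
  refine le_trans (le_of_eq ?_) (shrink _ fun i => by positivity)
  refine Finset.sum_congr rfl fun i hi => ?_
  have hi' := Finset.mem_range.1 hi
  have hj' := Finset.mem_range.1 hj
  rw [hD i hi'.le, hD (i + 1) hi', hD j hj'.le, hD (j + 1) hj']

/-! ### Variation of the Cameron–Martin paths -/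

/-- If the Gram matrix of `x` has mixed `ℓ^ρ(ℓ^1)` norm at most `V`, then the coefficients `⟪h, x i⟫`
are in `ℓ^q` with `1 / q = 1 / (2 ρ) + 1 / 2`. The sum of their `q`-th powers is `⟪h, y⟫` with
`y = ∑ βᵢ xᵢ`, `|βᵢ| = |⟪h, x i⟫| ^ (q - 1)`, and `‖y‖ ^ 2` is at most `∑ βⱼ² ∑ᵢ |⟪x i, x j⟫|`,
to which Hölder's inequality applies. -/
theorem sum_abs_inner_rpow_le {E : Type*} [SeminormedAddCommGroup E] [InnerProductSpace ℝ E]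
    {ρ q V : ℝ} (hρ : 1 ≤ ρ) (hq : q = (1 / (2 * ρ) + 1 / 2)⁻¹) (hV : 0 ≤ V) (x : ℕ → E) (n : ℕ)
    (hx : ∑ j ∈ Finset.range n, (∑ i ∈ Finset.range n, |inner ℝ (x i) (x j)|) ^ ρ ≤ V ^ ρ)
    (h : E) :
    ∑ i ∈ Finset.range n, |inner ℝ h (x i)| ^ q ≤ (‖h‖ * √V) ^ q := by
  have hρ0 : 0 < ρ := by linarith
  have hq' : q = 2 * ρ / (1 + ρ) := by rw [hq]; field_simp
  have hq1 : 1 ≤ q := by rw [hq', le_div_iff₀ (by linarith)]; linarith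
  have hq0 : 0 < q := by linarith
  set c : ℕ → ℝ := fun i => inner ℝ h (x i) with hc
  set β : ℕ → ℝ := fun i => SignType.sign (c i) * |c i| ^ (q - 1) with hβ
  set r : ℕ → ℝ := fun j => ∑ i ∈ Finset.range n, |inner ℝ (x i) (x j)| with hr
  set S := ∑ i ∈ Finset.range n, |c i| ^ q with hS
  have hr0 : ∀ j, 0 ≤ r j := fun j => Finset.sum_nonneg fun _ _ => abs_nonneg _
  have hS0 : 0 ≤ S := Finset.sum_nonneg fun _ _ => by positivity
  have hβc : ∀ i, β i * c i = |c i| ^ q := by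
    intro i
    rcases eq_or_ne (c i) 0 with h0 | h0
    · simp [hβ, h0, Real.zero_rpow hq0.ne']
    · have hpos : 0 < |c i| := abs_pos.2 h0
      calc β i * c i = (SignType.sign (c i) * c i) * |c i| ^ (q - 1) := by simp only [hβ]; ring
        _ = |c i| ^ (1 : ℝ) * |c i| ^ (q - 1) := by rw [sign_mul_self, Real.rpow_one]
        _ = _ := by rw [← Real.rpow_add hpos]; congr 1; ring
  have hβ2 : ∀ i, β i ^ 2 ≤ |c i| ^ (2 * (q - 1)) := by
    intro i
    have h1 : (SignType.sign (c i) : ℝ) ^ 2 ≤ 1 := by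
      rcases lt_trichotomy (c i) 0 with h0 | h0 | h0 <;> simp [h0]
    have h2 : (|c i| ^ (q - 1)) ^ 2 = |c i| ^ (2 * (q - 1)) := by
      rw [← Real.rpow_natCast, ← Real.rpow_mul (abs_nonneg _)]; congr 1; push_cast; ring
    simp only [hβ]
    rw [mul_pow, h2]
    exact mul_le_of_le_one_left (by positivity) h1
  set y := ∑ i ∈ Finset.range n, β i • x i with hy
  have hSy : S = inner ℝ h y := by
    rw [hy, inner_sum]
    refine Finset.sum_congr rfl fun i _ => ?_
    rw [inner_smul_right, ← hβc]
  have hy2 : ‖y‖ ^ 2 ≤ ∑ j ∈ Finset.range n, β j ^ 2 * r j := by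
    have e : ‖y‖ ^ 2 = ∑ i ∈ Finset.range n, ∑ j ∈ Finset.range n,
        β i * (β j * inner ℝ (x i) (x j)) := by
      rw [← real_inner_self_eq_norm_sq, hy, sum_inner]
      refine Finset.sum_congr rfl fun i _ => ?_
      rw [inner_sum]
      refine Finset.sum_congr rfl fun j _ => ?_
      rw [inner_smul_left, inner_smul_right]; simp
    have e1 : ∑ i ∈ Finset.range n, ∑ j ∈ Finset.range n, β j ^ 2 * |inner ℝ (x i) (x j)| =
        ∑ j ∈ Finset.range n, β j ^ 2 * r j := by
      rw [Finset.sum_comm]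
      exact Finset.sum_congr rfl fun j _ => by rw [hr, Finset.mul_sum]
    have e2 : ∑ i ∈ Finset.range n, ∑ j ∈ Finset.range n, β i ^ 2 * |inner ℝ (x i) (x j)| =
        ∑ j ∈ Finset.range n, β j ^ 2 * r j := by
      refine Finset.sum_congr rfl fun j _ => ?_
      rw [hr, Finset.mul_sum]
      exact Finset.sum_congr rfl fun i _ => by rw [real_inner_comm]
    have e3 : ∑ i ∈ Finset.range n, ∑ j ∈ Finset.range n, β i * (β j * inner ℝ (x i) (x j)) ≤
        ∑ i ∈ Finset.range n, ∑ j ∈ Finset.range n,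
          (β i ^ 2 * |inner ℝ (x i) (x j)| + β j ^ 2 * |inner ℝ (x i) (x j)|) / 2 := by
      refine Finset.sum_le_sum fun i _ => Finset.sum_le_sum fun j _ => ?_
      have h1 : β i * (β j * inner ℝ (x i) (x j)) ≤ |β i * β j| * |inner ℝ (x i) (x j)| := by
        rw [← mul_assoc, ← abs_mul]; exact le_abs_self _
      have h2 : |β i * β j| ≤ (β i ^ 2 + β j ^ 2) / 2 := by
        rw [abs_le]
        constructor <;> nlinarith [sq_nonneg (β i + β j), sq_nonneg (β i - β j)]
      have h3 := mul_le_mul_of_nonneg_right h2 (abs_nonneg (inner ℝ (x i) (x j) : ℝ))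
      linarith
    rw [e]
    refine e3.trans_eq ?_
    simp only [← Finset.sum_div, Finset.sum_add_distrib]
    rw [e1, e2]; ring
  have hβr : ∑ j ∈ Finset.range n, β j ^ 2 * r j ≤ S ^ ((ρ - 1) / ρ) * V := by
    refine (Finset.sum_le_sum fun j _ => mul_le_mul_of_nonneg_right (hβ2 j) (hr0 j)).trans ?_
    rcases hρ.eq_or_lt with h1 | h1
    · have hq2 : q = 1 := by rw [hq', ← h1]; norm_num
      rw [← h1] at hx
      simp only [hq2, ← h1, sub_self, mul_zero, Real.rpow_zero, one_mul, zero_div]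
      simpa using hx
    · have hconj : (ρ / (ρ - 1)).HolderConjugate ρ := by
        have := Real.HolderConjugate.conjExponent h1
        exact this.symm
      have hH := Real.inner_le_Lp_mul_Lq_of_nonneg (Finset.range n) hconj
        (f := fun j => |c j| ^ (2 * (q - 1))) (g := r) (fun _ _ => by positivity)
        (fun j _ => hr0 j)
      refine hH.trans ?_
      have hpow : ∀ j, (|c j| ^ (2 * (q - 1))) ^ (ρ / (ρ - 1)) = |c j| ^ q := by
        intro j
        rw [← Real.rpow_mul (abs_nonneg _)]
        congr 1
        have : ρ - 1 ≠ 0 := by linarith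
        rw [hq']; field_simp; ring
      simp only [hpow]
      rw [one_div_div]
      refine mul_le_mul_of_nonneg_left ?_ (by positivity)
      refine (Real.rpow_le_rpow (Finset.sum_nonneg fun j _ => Real.rpow_nonneg (hr0 j) _) hx
        (by positivity)).trans_eq ?_
      rw [← Real.rpow_mul hV, mul_one_div_cancel hρ0.ne', Real.rpow_one]
  rcases hS0.eq_or_lt with h0 | hSpos
  · rw [← h0]; positivity
  have hyle : ‖y‖ ≤ S ^ ((ρ - 1) / (2 * ρ)) * √V := by
    refine (sq_le_sq₀ (norm_nonneg _) (by positivity)).1 ?_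
    rw [mul_pow, Real.sq_sqrt hV, ← Real.rpow_mul_natCast hS0]
    refine (hy2.trans hβr).trans_eq ?_
    congr 2
    push_cast; field_simp
  have hSle : S ≤ S ^ ((ρ - 1) / (2 * ρ)) * (‖h‖ * √V) := by
    calc S ≤ ‖h‖ * ‖y‖ := by rw [hSy]; exact real_inner_le_norm h y
      _ ≤ ‖h‖ * (S ^ ((ρ - 1) / (2 * ρ)) * √V) :=
          mul_le_mul_of_nonneg_left hyle (norm_nonneg _)
      _ = _ := by ring
  have hSq : S ^ (1 / q) ≤ ‖h‖ * √V := by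
    have e : S = S ^ ((ρ - 1) / (2 * ρ)) * S ^ (1 / q) := by
      rw [← Real.rpow_add hSpos]
      have : (ρ - 1) / (2 * ρ) + 1 / q = 1 := by rw [hq']; field_simp; ring
      rw [this, Real.rpow_one]
    have hpos : 0 < S ^ ((ρ - 1) / (2 * ρ)) := by positivity
    exact le_of_mul_le_mul_left (e ▸ hSle) hpos
  calc S = (S ^ (1 / q)) ^ q := by
        rw [← Real.rpow_mul hS0, one_div_mul_cancel hq0.ne', Real.rpow_one]
    _ ≤ _ := Real.rpow_le_rpow (by positivity) hSq hq0.le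

namespace StepFun

variable {ι : Type*} {K : Matrix ι ι ℝ} {hK : K.PosSemidef}

theorem inner_ind_sub_ind (s t u v : ι) :
    inner ℝ (ind K hK t - ind K hK s) (ind K hK v - ind K hK u) = rectIncr K s t u v := by
  simp only [inner_sub_left, inner_sub_right, inner_ind, rectIncr]
  ring

/-- The paths `s ↦ ⟪h, 1_{[0, s]}⟫` have finite `q`-variation. -/
theorem variationLE_inner [Preorder ι] {ρ q V : ℝ} (hρ : 1 ≤ ρ)
    (hq : q = (1 / (2 * ρ) + 1 / 2)⁻¹) (hV : 0 ≤ V) {S : Set ι} (hKV : MixedVariationLE ρ V K S)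
    (h : StepFun K hK) : VariationLE q (‖h‖ * √V) (fun s => inner ℝ h (ind K hK s)) S := by
  intro x hx hxS m
  simp only [← inner_sub_right]
  refine sum_abs_inner_rpow_le hρ hq hV (fun i => ind K hK (x (i + 1)) - ind K hK (x i)) m ?_ h
  simp only [inner_ind_sub_ind]
  exact hKV x hx hxS m

/-- Duality: the norm of a tagged step function is estimated by applying Young's inequality to the
path `s ↦ ⟪h, 1_{[0, s]}⟫` of that step function `h` itself. -/
theorem norm_sum_le [Preorder ι] {ρ q p V A M : ℝ} (hρ : 1 ≤ ρ)
    (hq : q = (1 / (2 * ρ) + 1 / 2)⁻¹) (hp : 0 < p) (hpq : 1 < 1 / p + 1 / q) (hV : 0 ≤ V)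
    {S : Set ι} (hKV : MixedVariationLE ρ V K S) {f : ι → ℝ} (hA : 0 ≤ A)
    (hf : VariationLE p A f S) {x ξ : ℕ → ι} (hx : Monotone x) (hxS : ∀ k, x k ∈ S)
    (hξ : Monotone ξ) (hξS : ∀ k, ξ k ∈ S) (hM : |f (ξ 0)| ≤ M) (n : ℕ) :
    ‖∑ i ∈ Finset.range n, f (ξ i) • (ind K hK (x (i + 1)) - ind K hK (x i))‖ ≤
      (M + youngConst (1 / p + 1 / q) * A) * √V := by
  have hq0 : 0 < q := by rw [hq]; positivity
  set h := ∑ i ∈ Finset.range n, f (ξ i) • (ind K hK (x (i + 1)) - ind K hK (x i)) with hh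
  have h1 := young_sum_le hp hq0 hpq hA (by positivity)
    (hf.comp hξ (U := univ) fun k _ => hξS k)
    ((variationLE_inner (hK := hK) hρ hq hV hKV h).comp hx (U := univ) fun k _ => hxS k) hM n
  have h2 : ∑ i ∈ Finset.range n, f (ξ i) * (inner ℝ h (ind K hK (x (i + 1))) -
      inner ℝ h (ind K hK (x i))) = ‖h‖ ^ 2 := by
    rw [← real_inner_self_eq_norm_sq]
    conv_rhs => rw [hh, inner_sum, ← hh]
    refine Finset.sum_congr rfl fun i _ => ?_
    rw [inner_smul_right, inner_sub_right]
  rw [h2, abs_of_nonneg (sq_nonneg _)] at h1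
  rcases (norm_nonneg h).eq_or_lt with h0 | h0
  · rw [← h0]
    have := youngConst_nonneg (1 / p + 1 / q)
    have : 0 ≤ M := (abs_nonneg _).trans hM
    positivity
  · refine le_of_mul_le_mul_left ?_ h0
    linarith

end StepFun

/-! ### Refinements of dissections -/

namespace Dissection

variable {ι : Type*} [LinearOrder ι] {a b : ι}

/-- The largest index of a point of the dissection that is at most `s`. -/
def index (D : Dissection a b) (s : ι) : ℕ := Nat.findGreatest (fun i => D.pt i ≤ s) D.n

/-- The largest point of the dissection that is at most `s`. -/
def floor (D : Dissection a b) (s : ι) : ι := D.pt (D.index s)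

variable (D : Dissection a b)

theorem index_le (s : ι) : D.index s ≤ D.n := Nat.findGreatest_le _

theorem monotone_floor : Monotone D.floor := fun _ _ hst =>
  D.mono (Nat.findGreatest_mono_left (fun _ h => h.trans hst) _)

theorem floor_mem (s : ι) : D.floor s ∈ Icc a b := D.pt_mem (D.index_le s)

theorem floor_le {s : ι} (hs : a ≤ s) : D.floor s ≤ s :=
  Nat.findGreatest_spec (P := fun i => D.pt i ≤ s) (Nat.zero_le D.n) (D.first.le.trans hs)

theorem floor_pt {i : ℕ} (hi : i ≤ D.n) : D.floor (D.pt i) = D.pt i := by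
  refine le_antisymm (D.floor_le (D.pt_mem hi).1) (D.mono ?_)
  exact Nat.le_findGreatest (P := fun k => D.pt k ≤ D.pt i) hi le_rfl

theorem floor_eq {i : ℕ} (hi : i < D.n) {s : ι} (h1 : D.pt i ≤ s) (h2 : s < D.pt (i + 1)) :
    D.floor s = D.pt i := by
  have hle : i ≤ D.index s := Nat.le_findGreatest (P := fun k => D.pt k ≤ s) hi.le h1
  have hge : D.index s ≤ i := by
    by_contra hcon
    exact absurd (D.floor_le ((D.pt_mem hi.le).1.trans h1))
      (not_le.2 (h2.trans_le (D.mono (by omega : i + 1 ≤ D.index s))))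
  rw [floor, le_antisymm hge hle]

/-- A point is either the right end point, or in the interval of the dissection that starts at its
floor. -/
theorem eq_or_floor (s : ι) (hs : s ∈ Icc a b) :
    D.floor s = s ∨ D.index s < D.n ∧ D.pt (D.index s) ≤ s ∧ s ≤ D.pt (D.index s + 1) := by
  rcases (D.index_le s).eq_or_lt with h | h
  · left
    refine le_antisymm (D.floor_le hs.1) ?_
    rw [floor, h, D.last]; exact hs.2
  · right
    refine ⟨h, D.floor_le hs.1, ?_⟩
    have := Nat.findGreatest_is_greatest (P := fun k => D.pt k ≤ s) (Nat.lt_succ_self (D.index s)) h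
    exact (not_le.1 this).le

/-- A Riemann sum along a strictly increasing refinement `E` of `D`, against the path `H ∘ floor`
that is constant between the points of `D`, is a Riemann sum along `D`. -/
theorem sum_floor_eq {E : ℕ → ι} {N : ℕ} (hE : Monotone E)
    (hstrict : ∀ k l, k < l → l ≤ N → E k < E l) {m : ℕ → ℕ} (hm : Monotone m) (hm0 : m 0 = 0)
    (hmN : ∀ i, m i ≤ N) (hEm : ∀ i ≤ D.n, E (m i) = D.pt i) (f H : ι → ℝ) :
    ∀ i ≤ D.n, ∑ k ∈ Finset.range (m i), f (E k) * (H (D.floor (E (k + 1))) - H (D.floor (E k))) =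
      ∑ l ∈ Finset.range i,
        f (max (E (m (l + 1) - 1)) (D.pt l)) * (H (D.pt (l + 1)) - H (D.pt l)) := by
  intro i
  induction i with
  | zero => intro _; simp [hm0]
  | succ i ih =>
    intro hi
    rw [Finset.sum_range_succ, ← ih (by omega)]
    rcases (hm (show i ≤ i + 1 by omega)).eq_or_lt with h | h
    · have : D.pt (i + 1) = D.pt i := by rw [← hEm i (by omega), ← hEm (i + 1) hi, h]
      rw [this, ← h]; simp
    · obtain ⟨r, hr⟩ : ∃ r, m (i + 1) = r + 1 := ⟨m (i + 1) - 1, by omega⟩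
      have hfl : ∀ k, m i ≤ k → k ≤ r → D.floor (E k) = D.pt i := by
        intro k h1 h2
        refine D.floor_eq (by omega) ?_ ?_
        · rw [← hEm i (by omega)]; exact hE h1
        · rw [← hEm (i + 1) hi]; exact hstrict _ _ (by omega) (hmN _)
      have hr' : m i ≤ r := by omega
      rw [hr, Finset.sum_range_succ, ← Finset.sum_range_add_sum_Ico _ hr']
      have hz : ∑ k ∈ Finset.Ico (m i) r,
          f (E k) * (H (D.floor (E (k + 1))) - H (D.floor (E k))) = 0 := by
        refine Finset.sum_eq_zero fun k hk => ?_
        have hk' := Finset.mem_Ico.1 hk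
        rw [hfl k hk'.1 (by omega), hfl (k + 1) (by omega) (by omega), sub_self, mul_zero]
      have hEr : D.pt i ≤ E r := by rw [← hEm i (by omega)]; exact hE hr'
      rw [hz, add_zero, hfl r hr' le_rfl, ← hr, hEm (i + 1) hi, D.floor_pt hi, hr,
        Nat.add_sub_cancel, max_eq_left hEr]

end Dissection

/-- Increasing enumeration of a finite set of points. -/
theorem exists_enumeration {ι : Type*} [LinearOrder ι] (s : Finset ι) (hs : s.Nonempty) :
    ∃ (E : ℕ → ι) (N : ℕ), Monotone E ∧ (∀ k, E k ∈ s) ∧ (∀ k l, k < l → l ≤ N → E k < E l) ∧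
      ∀ x ∈ s, ∃ k ≤ N, E k = x := by
  have hc : 0 < s.card := hs.card_pos
  refine ⟨fun k => s.orderEmbOfFin rfl ⟨min k (s.card - 1), by omega⟩, s.card - 1, ?_, ?_, ?_, ?_⟩
  · intro k l hkl
    refine (s.orderEmbOfFin rfl).monotone ?_
    show min k _ ≤ min l _
    omega
  · exact fun k => s.orderEmbOfFin_mem rfl _
  · intro k l hkl hl
    refine (s.orderEmbOfFin rfl).strictMono ?_
    show min k _ < min l _
    omega
  · intro x hx
    have : x ∈ Set.range (s.orderEmbOfFin rfl) := by rw [s.range_orderEmbOfFin rfl]; exact hx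
    obtain ⟨⟨k, hk⟩, rfl⟩ := this
    refine ⟨k, by omega, ?_⟩
    exact congrArg _ (Fin.ext (by show min k _ = k; omega))

/-- Positions of the points of a dissection within a refinement. -/
theorem Dissection.exists_positions {ι : Type*} [LinearOrder ι] {a b : ι} (D : Dissection a b)
    {E : ℕ → ι} {N : ℕ} (hEmem : ∀ k, E k ∈ Icc a b)
    (hstrict : ∀ k l, k < l → l ≤ N → E k < E l) (hD : ∀ i ≤ D.n, ∃ k ≤ N, E k = D.pt i) :
    ∃ m : ℕ → ℕ, Monotone m ∧ m 0 = 0 ∧ m D.n = N ∧ (∀ i, m i ≤ N) ∧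
      ∀ i ≤ D.n, E (m i) = D.pt i := by
  choose m hmN hm using fun i : ℕ => hD (min i D.n) (min_le_right _ _)
  have hm' : ∀ i ≤ D.n, E (m i) = D.pt i := fun i hi => by rw [hm, min_eq_left hi]
  refine ⟨m, ?_, ?_, ?_, hmN, hm'⟩
  · intro i j hij
    by_contra! hcon
    have h1 := hstrict _ _ hcon (hmN i)
    rw [hm, hm] at h1
    exact absurd (D.mono (by omega : min i D.n ≤ min j D.n)) (not_le.2 h1)
  · by_contra hcon
    have h1 := hstrict 0 (m 0) (Nat.pos_of_ne_zero hcon) (hmN 0)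
    rw [hm' 0 (Nat.zero_le _), D.first] at h1
    exact absurd (hEmem 0).1 (not_le.2 h1)
  · by_contra hcon
    have h1 := hstrict (m D.n) N (lt_of_le_of_ne (hmN _) hcon) le_rfl
    rw [hm' D.n le_rfl, D.last] at h1
    exact absurd (hEmem N).2 (not_le.2 h1)

/-! ### Convergence of the step approximations -/

namespace StepFun

variable {ι : Type*} {K : Matrix ι ι ℝ} {hK : K.PosSemidef}

/-- Comparison of a step approximation along `D` with that along a refinement `E` of `D`, when the
increments of `1_{[0, s]}` within the intervals of `D` have norm at most `w`. Against a path
`H = ⟪h, 1_{[0, ·]}⟫`, the difference consists of a Riemann sum against the path `H - H ∘ floor`,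
which is small in `q'`-variation for `q' > q`, and of a difference of two Riemann sums along `D`. -/
theorem norm_refinement_sub_stepApprox_le [LinearOrder ι] {ρ q q' p V A M w : ℝ} (hρ : 1 ≤ ρ)
    (hq : q = (1 / (2 * ρ) + 1 / 2)⁻¹) (hqq : q < q') (hp : 0 < p) (hpq : 1 < 1 / p + 1 / q')
    (hV : 0 ≤ V) {a b : ι} (hKV : MixedVariationLE ρ V K (Icc a b)) {f : ι → ℝ} (hA : 0 ≤ A)
    (hf : VariationLE p A f (Icc a b)) (hM : |f a| ≤ M) (hw : 0 ≤ w) (D : Dissection a b)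
    (hDw : ∀ i < D.n, ∀ s, D.pt i ≤ s → s ≤ D.pt (i + 1) → ‖ind K hK s - ind K hK (D.pt i)‖ ≤ w)
    {ξ : ℕ → ι} (hξ : ∀ i < D.n, D.pt i ≤ ξ i ∧ ξ i ≤ D.pt (i + 1))
    {E : ℕ → ι} {N : ℕ} (hE : Monotone E) (hEmem : ∀ k, E k ∈ Icc a b)
    (hstrict : ∀ k l, k < l → l ≤ N → E k < E l) (hDE : ∀ i ≤ D.n, ∃ k ≤ N, E k = D.pt i) :
    ‖∑ k ∈ Finset.range N, f (E k) • (ind K hK (E (k + 1)) - ind K hK (E k)) -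
      stepApprox K hK f D ξ‖ ≤
      (M + youngConst (1 / p + 1 / q') * A + A) *
        ((2 * w) ^ (1 - q / q') * (4 * √V) ^ (q / q')) := by
  have hq1 : 1 ≤ q := by
    have : q = 2 * ρ / (1 + ρ) := by rw [hq]; field_simp
    rw [this, le_div_iff₀ (by linarith)]; linarith
  have hq0 : 0 < q := by linarith
  have hq'0 : 0 < q' := by linarith
  have hqr : 0 ≤ 1 - q / q' := by
    rw [sub_nonneg, div_le_one hq'0]; exact hqq.le
  obtain ⟨m, hm, hm0, hmN, hmle, hEm⟩ := D.exists_positions hEmem hstrict hDE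
  have hab : a ≤ b := (hEmem 0).1.trans (hEmem 0).2
  have hE0 : E 0 = a := by rw [← hm0, hEm 0 (Nat.zero_le _), D.first]
  set h := ∑ k ∈ Finset.range N, f (E k) • (ind K hK (E (k + 1)) - ind K hK (E k)) -
      stepApprox K hK f D ξ with hh
  set H : ι → ℝ := fun s => inner ℝ h (ind K hK s) with hH
  set κ := (2 * w) ^ (1 - q / q') * (4 * √V) ^ (q / q') with hκ
  have hHvar : VariationLE q (‖h‖ * √V) H (Icc a b) := variationLE_inner hρ hq hV hKV h
  have hHsub : ∀ s t, |H t - H s| ≤ ‖h‖ * ‖ind K hK t - ind K hK s‖ := fun s t => by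
    rw [hH]; simp only [← inner_sub_right]; exact abs_real_inner_le_norm _ _
  have hfloor : ∀ s ∈ Icc a b, |H s - H (D.floor s)| ≤ ‖h‖ * w := by
    intro s hs
    rcases D.eq_or_floor s hs with h1 | ⟨h1, h2, h3⟩
    · rw [h1, sub_self, abs_zero]; positivity
    · exact (hHsub _ _).trans (mul_le_mul_of_nonneg_left (hDw _ h1 s h2 h3) (norm_nonneg _))
  -- the scale of the two `q'`-variation bounds
  have hscale : (2 * (‖h‖ * w)) ^ (1 - q / q') * (4 * (‖h‖ * √V)) ^ (q / q') = ‖h‖ * κ := by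
    rw [show 2 * (‖h‖ * w) = ‖h‖ * (2 * w) by ring, show 4 * (‖h‖ * √V) = ‖h‖ * (4 * √V) by ring,
      Real.mul_rpow (norm_nonneg _) (by positivity), Real.mul_rpow (norm_nonneg _) (by positivity)]
    have : ‖h‖ ^ (1 - q / q') * ‖h‖ ^ (q / q') = ‖h‖ := by
      rw [← Real.rpow_add' (norm_nonneg _) (by simp)]; simp
    calc _ = (‖h‖ ^ (1 - q / q') * ‖h‖ ^ (q / q')) * κ := by rw [hκ]; ring
      _ = _ := by rw [this]
  have hbvar : VariationLE q' (‖h‖ * κ) (fun s => H s - H (D.floor s)) (Icc a b) := by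
    have h1 := hHvar.sub (hHvar.comp D.monotone_floor (U := Icc a b) fun s _ => D.floor_mem s)
      hq1 (by positivity)
    have h2 := h1.interpolate (q' := q') (w := 2 * (‖h‖ * w)) (by positivity) hq0 hqq
      (by positivity) (fun s hs t ht => by
        have := abs_sub (H t - H (D.floor t)) (H s - H (D.floor s))
        linarith [hfloor s hs, hfloor t ht])
    rwa [hscale] at h2
  have hyoung := young_sum_le (M := M) hp hq'0 hpq hA (by positivity)
    (hf.comp hE (U := univ) fun k _ => hEmem k) (hbvar.comp hE (U := univ) fun k _ => hEmem k)
    (by rw [hE0]; exact hM) N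
  set η : ℕ → ι := fun l => max (E (m (l + 1) - 1)) (D.pt l) with hη
  have hηmem : ∀ i < D.n, D.pt i ≤ η i ∧ η i ≤ D.pt (i + 1) := by
    intro i hi
    refine ⟨le_max_right _ _, max_le ?_ (D.mono (Nat.le_succ i))⟩
    rw [← hEm (i + 1) hi]; exact hE (Nat.sub_le _ _)
  have hsum := D.sum_floor_eq hE hstrict hm hm0 hmle hEm f H D.n le_rfl
  rw [hmN] at hsum
  have hsplit : ∑ k ∈ Finset.range N, f (E k) * (H (E (k + 1)) - H (D.floor (E (k + 1))) -
        (H (E k) - H (D.floor (E k)))) +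
      ∑ i ∈ Finset.range D.n, (f (η i) - f (ξ i)) * (H (D.pt (i + 1)) - H (D.pt i)) =
        ‖h‖ ^ 2 := by
    have e1 : ‖h‖ ^ 2 = ∑ k ∈ Finset.range N, f (E k) * (H (E (k + 1)) - H (E k)) -
        ∑ i ∈ Finset.range D.n, f (ξ i) * (H (D.pt (i + 1)) - H (D.pt i)) := by
      rw [← real_inner_self_eq_norm_sq]
      conv_lhs => rw [hh, inner_sub_right, inner_sum, stepApprox, inner_sum, ← stepApprox, ← hh]
      simp only [inner_smul_right, inner_sub_right, hH]
    have e2 : ∑ i ∈ Finset.range D.n, (f (η i) - f (ξ i)) * (H (D.pt (i + 1)) - H (D.pt i)) =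
        ∑ i ∈ Finset.range D.n, f (η i) * (H (D.pt (i + 1)) - H (D.pt i)) -
        ∑ i ∈ Finset.range D.n, f (ξ i) * (H (D.pt (i + 1)) - H (D.pt i)) := by
      rw [← Finset.sum_sub_distrib]
      exact Finset.sum_congr rfl fun i _ => by ring
    rw [e1, e2, ← hsum, ← add_sub_assoc, ← Finset.sum_add_distrib]
    congr 1
    exact Finset.sum_congr rfl fun i _ => by ring
  -- the difference of the two Riemann sums along `D`
  have hdiff : |∑ i ∈ Finset.range D.n, (f (η i) - f (ξ i)) * (H (D.pt (i + 1)) - H (D.pt i))| ≤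
      A * (‖h‖ * κ) := by
    refine (Finset.abs_sum_le_sum_abs _ _).trans ?_
    refine sum_mul_le_of_one_le hp hq'0 hpq.le hA (by positivity) ?_ ?_
    · have := hf.sum_le_of_disjoint (u := fun i => if i < D.n then min (η i) (ξ i) else b)
        (v := fun i => if i < D.n then max (η i) (ξ i) else b) ?_ ?_ ?_ ?_ D.n
      · refine le_trans (le_of_eq ?_) this
        refine Finset.sum_congr rfl fun i hi => ?_
        rw [if_pos (Finset.mem_range.1 hi), if_pos (Finset.mem_range.1 hi)]
        congr 1
        rcases le_total (η i) (ξ i) with h1 | h1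
        · rw [max_eq_right h1, min_eq_left h1, abs_sub_comm]
        · rw [max_eq_left h1, min_eq_right h1]
      · intro i
        split_ifs
        · exact min_le_left _ _ |>.trans (le_max_left _ _)
        · exact le_rfl
      · intro i
        by_cases h1 : i + 1 < D.n
        · rw [if_pos (by omega), if_pos h1]
          exact (max_le (hηmem i (by omega)).2 (hξ i (by omega)).2).trans
            (le_min (hηmem _ h1).1 (hξ _ h1).1)
        · rw [if_neg h1]
          split_ifs with h2
          · exact (max_le (hηmem i h2).2 (hξ i h2).2).trans (D.pt_mem h2).2
          · exact le_rfl
      · intro i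
        split_ifs with h2
        · exact ⟨(D.pt_mem h2.le).1.trans (le_min (hηmem i h2).1 (hξ i h2).1),
            (min_le_left _ _).trans ((hηmem i h2).2.trans (D.pt_mem h2).2)⟩
        · exact ⟨hab, le_rfl⟩
      · intro i
        split_ifs with h2
        · exact ⟨(D.pt_mem h2.le).1.trans ((hηmem i h2).1.trans (le_max_left _ _)),
            (max_le (hηmem i h2).2 (hξ i h2).2).trans (D.pt_mem h2).2⟩
        · exact ⟨hab, le_rfl⟩
    · have hclamp : ∀ k, D.pt (min k D.n) ∈ Icc a b := fun k => D.pt_mem (min_le_right _ _)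
      have h1 := hHvar (fun k => D.pt (min k D.n)) (fun k l hkl => D.mono (by omega)) hclamp D.n
      have h2 : ∑ i ∈ Finset.range D.n, |H (D.pt (i + 1)) - H (D.pt i)| ^ q ≤
          (4 * (‖h‖ * √V)) ^ q := by
        refine (le_of_eq (Finset.sum_congr rfl fun i hi => ?_)).trans (h1.trans ?_)
        · have := Finset.mem_range.1 hi
          rw [min_eq_left this.le, min_eq_left (show i + 1 ≤ D.n from this)]
        · refine Real.rpow_le_rpow (by positivity) ?_ hq0.le
          have : 0 ≤ ‖h‖ * √V := by positivity
          linarith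
      have h3 := sum_rpow_le_of_abs_le (q' := q') (w := 2 * (‖h‖ * w)) (by positivity) hq0 hqq
        (by positivity) (fun i hi => (hHsub (D.pt i) (D.pt (i + 1))).trans (by
          have := mul_le_mul_of_nonneg_left (hDw i hi _ (D.mono (Nat.le_succ i)) le_rfl)
            (norm_nonneg h)
          have h0 : 0 ≤ ‖h‖ * w := by positivity
          linarith)) h2
      rwa [hscale] at h3
  have hfinal : ‖h‖ ^ 2 ≤ (M + youngConst (1 / p + 1 / q') * A) * (‖h‖ * κ) + A * (‖h‖ * κ) := by
    rw [← hsplit]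
    exact add_le_add ((le_abs_self _).trans hyoung) ((le_abs_self _).trans hdiff)
  have hκ0 : 0 ≤ κ := by positivity
  have hM0 : 0 ≤ M := (abs_nonneg _).trans hM
  have hY := youngConst_nonneg (1 / p + 1 / q')
  rcases (norm_nonneg h).eq_or_lt with h0 | h0
  · rw [← h0]; positivity
  · refine le_of_mul_le_mul_left ?_ h0
    linarith

/-- Any two step approximations with small increments of `1_{[0, s]}` are close. -/
theorem norm_stepApprox_sub_stepApprox_le [LinearOrder ι] {ρ q q' p V A M w : ℝ} (hρ : 1 ≤ ρ)
    (hq : q = (1 / (2 * ρ) + 1 / 2)⁻¹) (hqq : q < q') (hp : 0 < p) (hpq : 1 < 1 / p + 1 / q')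
    (hV : 0 ≤ V) {a b : ι} (hKV : MixedVariationLE ρ V K (Icc a b)) {f : ι → ℝ} (hA : 0 ≤ A)
    (hf : VariationLE p A f (Icc a b)) (hM : |f a| ≤ M) (hw : 0 ≤ w) (D D' : Dissection a b)
    (hDw : ∀ i < D.n, ∀ s, D.pt i ≤ s → s ≤ D.pt (i + 1) → ‖ind K hK s - ind K hK (D.pt i)‖ ≤ w)
    (hDw' : ∀ i < D'.n, ∀ s, D'.pt i ≤ s → s ≤ D'.pt (i + 1) →
      ‖ind K hK s - ind K hK (D'.pt i)‖ ≤ w)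
    {ξ ξ' : ℕ → ι} (hξ : ∀ i < D.n, D.pt i ≤ ξ i ∧ ξ i ≤ D.pt (i + 1))
    (hξ' : ∀ i < D'.n, D'.pt i ≤ ξ' i ∧ ξ' i ≤ D'.pt (i + 1)) :
    ‖stepApprox K hK f D ξ - stepApprox K hK f D' ξ'‖ ≤
      2 * ((M + youngConst (1 / p + 1 / q') * A + A) *
        ((2 * w) ^ (1 - q / q') * (4 * √V) ^ (q / q'))) := by
  obtain ⟨E, N, hE, hEs, hstrict, hsurj⟩ := exists_enumeration
    ((Finset.range (D.n + 1)).image D.pt ∪ (Finset.range (D'.n + 1)).image D'.pt)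
    ⟨D.pt 0, Finset.mem_union_left _ (Finset.mem_image_of_mem _ (by simp))⟩
  have hEmem : ∀ k, E k ∈ Icc a b := by
    intro k
    rcases Finset.mem_union.1 (hEs k) with h | h <;>
      obtain ⟨i, hi, h2⟩ := Finset.mem_image.1 h <;> rw [← h2]
    · exact D.pt_mem (Nat.lt_succ_iff.1 (Finset.mem_range.1 hi))
    · exact D'.pt_mem (Nat.lt_succ_iff.1 (Finset.mem_range.1 hi))
  have h1 := norm_refinement_sub_stepApprox_le (hK := hK) hρ hq hqq hp hpq hV hKV hA hf hM hw D hDw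
    hξ hE hEmem hstrict fun i hi => hsurj _ (Finset.mem_union_left _
      (Finset.mem_image_of_mem _ (Finset.mem_range.2 (Nat.lt_succ_iff.2 hi))))
  have h2 := norm_refinement_sub_stepApprox_le (hK := hK) hρ hq hqq hp hpq hV hKV hA hf hM hw D'
    hDw' hξ' hE hEmem hstrict fun i hi => hsurj _ (Finset.mem_union_right _
      (Finset.mem_image_of_mem _ (Finset.mem_range.2 (Nat.lt_succ_iff.2 hi))))
  set G := ∑ k ∈ Finset.range N, f (E k) • (ind K hK (E (k + 1)) - ind K hK (E k))
  calc ‖stepApprox K hK f D ξ - stepApprox K hK f D' ξ'‖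
      = ‖(G - stepApprox K hK f D' ξ') - (G - stepApprox K hK f D ξ)‖ := by
        rw [sub_sub_sub_cancel_left]
    _ ≤ _ := (norm_sub_le _ _).trans (by linarith)

end StepFun

section

open Filter Topology

/-! ### Grids through a given point -/

/-- The points of the grid that divides `[0, t]` and `[t, T]` into `N` equal intervals each. -/
noncomputable def gridPt {T : ℝ} (t : Icc (0 : ℝ) T) (N k : ℕ) : Icc (0 : ℝ) T :=
  ⟨t * ((min k N : ℕ) / (N : ℝ)) + (T - t) * ((min (k - N) N : ℕ) / (N : ℝ)), by
    have h1 := t.2.1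
    have h2 : 0 ≤ T - t := sub_nonneg.2 t.2.2
    have hle : ∀ l : ℕ, ((min l N : ℕ) : ℝ) / (N : ℝ) ≤ 1 := fun l =>
      div_le_one_of_le₀ (by exact_mod_cast min_le_right _ _) (by positivity)
    constructor
    · positivity
    · nlinarith [mul_le_mul_of_nonneg_left (hle k) h1, mul_le_mul_of_nonneg_left (hle (k - N)) h2]⟩

section Grid

variable {T : ℝ} {t : Icc (0 : ℝ) T} {N : ℕ}

theorem coe_gridPt (t : Icc (0 : ℝ) T) (N k : ℕ) : (gridPt t N k : ℝ) =
    t * ((min k N : ℕ) / (N : ℝ)) + (T - t) * ((min (k - N) N : ℕ) / (N : ℝ)) := rfl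

theorem monotone_gridPt (t : Icc (0 : ℝ) T) (N : ℕ) : Monotone (gridPt t N) := by
  intro k l hkl
  have h1 := t.2.1
  have h2 : 0 ≤ T - t := sub_nonneg.2 t.2.2
  rw [← Subtype.coe_le_coe, coe_gridPt, coe_gridPt]
  have h3 : ((min k N : ℕ) : ℝ) ≤ (min l N : ℕ) := by exact_mod_cast (by omega)
  have h4 : ((min (k - N) N : ℕ) : ℝ) ≤ (min (l - N) N : ℕ) := by exact_mod_cast (by omega)
  gcongr

theorem coe_gridPt_zero (t : Icc (0 : ℝ) T) (N : ℕ) : (gridPt t N 0 : ℝ) = 0 := by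
  simp [coe_gridPt]

theorem gridPt_self (hN : 0 < N) : gridPt t N N = t := by
  have : (N : ℝ) ≠ 0 := by positivity
  ext
  simp [coe_gridPt, this]

theorem coe_gridPt_two_mul (hN : 0 < N) : (gridPt t N (2 * N) : ℝ) = T := by
  have : (N : ℝ) ≠ 0 := by positivity
  have h1 : min (2 * N) N = N := by omega
  have h2 : min (2 * N - N) N = N := by omega
  rw [coe_gridPt, h1, h2, div_self this]; ring

theorem dist_gridPt_le (k : ℕ) : dist (gridPt t N k) (gridPt t N (k + 1)) ≤ T / N := by
  have h1 := t.2.1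
  have h2 : 0 ≤ T - t := sub_nonneg.2 t.2.2
  have hm : (gridPt t N k : ℝ) ≤ gridPt t N (k + 1) := monotone_gridPt t N (Nat.le_succ k)
  rw [Subtype.dist_eq, Real.dist_eq, abs_sub_comm, abs_of_nonneg (sub_nonneg.2 hm), coe_gridPt,
    coe_gridPt]
  have h3 : ((min (k + 1) N : ℕ) : ℝ) ≤ (min k N : ℕ) + 1 := by exact_mod_cast (by omega)
  have h4 : ((min (k + 1 - N) N : ℕ) : ℝ) ≤ (min (k - N) N : ℕ) + 1 := by exact_mod_cast (by omega)
  calc _ ≤ (t : ℝ) * (((min k N : ℕ) + 1) / (N : ℝ)) +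
        (T - t) * (((min (k - N) N : ℕ) + 1) / (N : ℝ)) -
        (t * ((min k N : ℕ) / (N : ℝ)) + (T - t) * ((min (k - N) N : ℕ) / (N : ℝ))) := by gcongr
    _ = T / N := by ring

/-- The grid as a dissection of `[0, T]`. -/
noncomputable def grid (t : Icc (0 : ℝ) T) {o e : Icc (0 : ℝ) T} (ho : (o : ℝ) = 0)
    (he : (e : ℝ) = T) (hN : 0 < N) : Dissection o e where
  n := 2 * N
  pt := gridPt t N
  mono := monotone_gridPt t N
  first := Subtype.ext (by rw [coe_gridPt_zero, ho])
  last := Subtype.ext (by rw [coe_gridPt_two_mul hN, he])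

theorem exists_mesh_lt (T : ℝ) {δ : ℝ} (hδ : 0 < δ) : ∃ N : ℕ, 0 < N ∧ T / N < δ := by
  obtain ⟨N, hN⟩ := exists_nat_gt (max (T / δ) 0)
  have hN0 : (0 : ℝ) < N := (le_max_right _ _).trans_lt hN
  refine ⟨N, by exact_mod_cast hN0, ?_⟩
  have := (le_max_left _ _).trans_lt hN
  rw [div_lt_iff₀ hδ] at this
  rw [div_lt_iff₀ hN0]; linarith

end Grid

/-! ### Elements of the Hilbert space defined by functions -/

section Represents

variable {T : ℝ} {K : Matrix (Icc (0 : ℝ) T) (Icc (0 : ℝ) T) ℝ} {hK : K.PosSemidef}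
  {o e : Icc (0 : ℝ) T}

/-- Functions of finite `p`-variation belong to the Hilbert space: their step approximations form
a Cauchy net. -/
theorem exists_represents (ho : (o : ℝ) = 0) (he : (e : ℝ) = T)
    (hcont : Continuous (StepFun.ind K hK)) {ρ q p V A : ℝ} (hρ : 1 ≤ ρ)
    (hq : q = (1 / (2 * ρ) + 1 / 2)⁻¹) (hp : 1 ≤ p) (hpq : 1 < 1 / p + 1 / q)
    (hV : 0 ≤ V) (hKV : MixedVariationLE ρ V K (Icc o e)) {f : Icc (0 : ℝ) T → ℝ} (hA : 0 ≤ A)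
    (hf : VariationLE p A f (Icc o e)) : ∃ h : WienerSpace K hK, Represents o e f h := by
  have hp0 : 0 < p := by linarith
  have hq0 : 0 < q := by rw [hq]; positivity
  -- there is room for a larger exponent `q'`
  obtain ⟨q', hqq, hpq'⟩ : ∃ q', q < q' ∧ 1 < 1 / p + 1 / q' := by
    have h1 : 1 / p ≤ 1 := by rw [div_le_one hp0]; exact hp
    have h2 : 0 < 1 / q := by positivity
    refine ⟨2 / (1 / q + (1 - 1 / p)), ?_, ?_⟩
    · rw [lt_div_iff₀ (by linarith)]
      have h3 : q * (1 / q) = 1 := by field_simp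
      have h4 : q * (1 - 1 / p) < q * (1 / q) := mul_lt_mul_of_pos_left (by linarith) hq0
      linarith
    · rw [one_div_div]; linarith
  have hq'0 : 0 < q' := hq0.trans hqq
  set M := |f o| with hM
  set bd : ℝ → ℝ := fun w => 2 * ((M + youngConst (1 / p + 1 / q') * A + A) *
        ((2 * w) ^ (1 - q / q') * (4 * √V) ^ (q / q'))) with hbd
  have hbd0 : Tendsto bd (𝓝[>] 0) (𝓝 0) := by
    have hc : Continuous bd := by
      have : 0 ≤ 1 - q / q' := by rw [sub_nonneg, div_le_one hq'0]; exact hqq.le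
      have h1 : Continuous fun w : ℝ => (2 * w) ^ (1 - q / q') :=
        (Real.continuous_rpow_const this).comp (continuous_const.mul continuous_id)
      exact continuous_const.mul (continuous_const.mul (h1.mul continuous_const))
    have h0 : bd 0 = 0 := by
      have : 1 - q / q' ≠ 0 := by
        have : q / q' < 1 := by rw [div_lt_one hq'0]; exact hqq
        linarith
      simp [hbd, Real.zero_rpow this]
    have := hc.tendsto 0
    rw [h0] at this
    exact this.mono_left nhdsWithin_le_nhds
  have hunif := CompactSpace.uniformContinuous_of_continuous hcont
  have hcauchy : ∀ ε : ℝ, 0 < ε → ∃ δ : ℝ, 0 < δ ∧ ∀ (D D' : Dissection o e) (ξ ξ' : ℕ → _),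
      (∀ i < D.n, D.pt i ≤ ξ i ∧ ξ i ≤ D.pt (i + 1)) →
      (∀ i < D'.n, D'.pt i ≤ ξ' i ∧ ξ' i ≤ D'.pt (i + 1)) →
      (∀ i < D.n, dist (D.pt i) (D.pt (i + 1)) < δ) →
      (∀ i < D'.n, dist (D'.pt i) (D'.pt (i + 1)) < δ) →
      ‖stepApprox K hK f D ξ - stepApprox K hK f D' ξ'‖ ≤ ε := by
    intro ε hε
    obtain ⟨w, hwε, hw⟩ : ∃ w, bd w < ε ∧ 0 < w :=
      ((hbd0.eventually (gt_mem_nhds hε)).and self_mem_nhdsWithin).exists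
    obtain ⟨δ, hδ, hφ⟩ := Metric.uniformContinuous_iff.1 hunif w hw
    have hmesh : ∀ D : Dissection o e, (∀ i < D.n, dist (D.pt i) (D.pt (i + 1)) < δ) →
        ∀ i < D.n, ∀ s, D.pt i ≤ s → s ≤ D.pt (i + 1) →
          ‖StepFun.ind K hK s - StepFun.ind K hK (D.pt i)‖ ≤ w := by
      intro D hD i hi s h1 h2
      rw [← dist_eq_norm]
      refine (hφ ?_).le
      refine lt_of_le_of_lt ?_ (hD i hi)
      have h1' : ((D.pt i : Icc (0 : ℝ) T) : ℝ) ≤ s := h1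
      have h2' : (s : ℝ) ≤ D.pt (i + 1) := h2
      rw [Subtype.dist_eq, Subtype.dist_eq, Real.dist_eq, Real.dist_eq,
        abs_of_nonneg (by linarith), abs_of_nonpos (by linarith)]
      linarith
    refine ⟨δ, hδ, fun D D' ξ ξ' hξ hξ' hD hD' => ?_⟩
    exact (StepFun.norm_stepApprox_sub_stepApprox_le hρ hq hqq hp0 hpq' hV hKV hA hf le_rfl hw.le
      D D' (hmesh D hD) (hmesh D' hD') hξ hξ').trans hwε.le
  choose N hN hNT using fun k : ℕ =>
    exists_mesh_lt T (show (0 : ℝ) < 1 / ((k : ℝ) + 1) by positivity)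
  set S : ℕ → WienerSpace K hK := fun k =>
    (stepApprox K hK f (grid o ho he (hN k)) (gridPt o (N k)) : StepFun K hK) with hS
  have htag : ∀ k, ∀ i < (grid o ho he (hN k)).n, (grid o ho he (hN k)).pt i ≤ gridPt o (N k) i ∧
      gridPt o (N k) i ≤ (grid o ho he (hN k)).pt (i + 1) :=
    fun k i _ => ⟨le_rfl, monotone_gridPt _ _ (Nat.le_succ i)⟩
  have hmesh : ∀ δ : ℝ, 0 < δ → ∃ k₀ : ℕ, ∀ k ≥ k₀, ∀ i < (grid o ho he (hN k)).n,
      dist ((grid o ho he (hN k)).pt i) ((grid o ho he (hN k)).pt (i + 1)) < δ := by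
    intro δ hδ
    obtain ⟨k₀, hk₀⟩ := exists_nat_one_div_lt hδ
    refine ⟨k₀, fun k hk i _ => (dist_gridPt_le i).trans_lt ((hNT k).trans_le ?_)⟩
    exact (Nat.one_div_le_one_div hk).trans hk₀.le
  have hSc : CauchySeq S := by
    refine Metric.cauchySeq_iff.2 fun ε hε => ?_
    obtain ⟨δ, hδ, h⟩ := hcauchy (ε / 2) (by positivity)
    obtain ⟨k₀, hk₀⟩ := hmesh δ hδ
    refine ⟨k₀, fun k hk l hl => ?_⟩
    rw [dist_eq_norm, hS]
    dsimp only
    rw [← UniformSpace.Completion.coe_sub, UniformSpace.Completion.norm_coe]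
    linarith [h _ _ _ _ (htag k) (htag l) (hk₀ k hk) (hk₀ l hl)]
  obtain ⟨h, hh⟩ := cauchySeq_tendsto_of_complete hSc
  refine ⟨h, fun ε hε => ?_⟩
  obtain ⟨δ, hδ, hc⟩ := hcauchy (ε / 2) (by positivity)
  obtain ⟨k₀, hk₀⟩ := hmesh δ hδ
  refine ⟨δ, hδ, fun D ξ hξ hD => ?_⟩
  have hlim : Tendsto (fun k => ‖(stepApprox K hK f D ξ : WienerSpace K hK) - S k‖) atTop
      (𝓝 ‖(stepApprox K hK f D ξ : WienerSpace K hK) - h‖) :=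
    (tendsto_const_nhds.sub hh).norm
  refine (le_of_tendsto hlim ?_).trans_lt (half_lt_self hε)
  filter_upwards [eventually_ge_atTop k₀] with k hk
  rw [hS]
  dsimp only
  rw [← UniformSpace.Completion.coe_sub, UniformSpace.Completion.norm_coe]
  exact hc _ _ _ _ hξ (htag k) hD (hk₀ k hk)

/-- A function that vanishes after `t` is approximated by tagged sums over a grid of `[0, t]`. -/
theorem Represents.exists_grid (ho : (o : ℝ) = 0) (he : (e : ℝ) = T) {f : Icc (0 : ℝ) T → ℝ}
    {h : WienerSpace K hK} (hh : Represents o e f h) {t : Icc (0 : ℝ) T}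
    (hft : ∀ s, t < s → f s = 0) {ε : ℝ} (hε : 0 < ε) :
    ∃ N : ℕ, 0 < N ∧ ∀ ξ : ℕ → Icc (0 : ℝ) T,
      (∀ i < N, gridPt t N i ≤ ξ i ∧ ξ i ≤ gridPt t N (i + 1)) →
      ‖((∑ i ∈ Finset.range N, f (ξ i) • (StepFun.ind K hK (gridPt t N (i + 1)) -
        StepFun.ind K hK (gridPt t N i)) : StepFun K hK) : WienerSpace K hK) - h‖ < ε := by
  obtain ⟨δ, hδ, hD⟩ := hh ε hε
  obtain ⟨N, hN, hNT⟩ := exists_mesh_lt T hδ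
  refine ⟨N, hN, fun ξ hξ => ?_⟩
  have h1 := hD (grid t ho he hN) (fun i => if i < N then ξ i else gridPt t N (i + 1))
    (fun i _ => by
      split_ifs with hi
      · exact hξ i hi
      · exact ⟨monotone_gridPt t N (Nat.le_succ i), le_rfl⟩)
    (fun i _ => (dist_gridPt_le i).trans_lt hNT)
  have h2 : stepApprox K hK f (grid t ho he hN)
      (fun i => if i < N then ξ i else gridPt t N (i + 1)) =
      ∑ i ∈ Finset.range N, f (ξ i) • (StepFun.ind K hK (gridPt t N (i + 1)) -
        StepFun.ind K hK (gridPt t N i)) := by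
    have hle : N ≤ 2 * N := by omega
    rw [stepApprox, show (grid t ho he hN).n = 2 * N from rfl,
      show (grid t ho he hN).pt = gridPt t N from rfl, ← Finset.sum_range_add_sum_Ico _ hle]
    have hz : ∑ i ∈ Finset.Ico N (2 * N), f (if i < N then ξ i else gridPt t N (i + 1)) •
        (StepFun.ind K hK (gridPt t N (i + 1)) - StepFun.ind K hK (gridPt t N i)) = 0 := by
      refine Finset.sum_eq_zero fun i hi => ?_
      have hi' := Finset.mem_Ico.1 hi
      have hti : t ≤ gridPt t N i := by
        conv_lhs => rw [← gridPt_self (t := t) hN]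
        exact monotone_gridPt t N hi'.1
      have hii := monotone_gridPt t N (Nat.le_succ i)
      rw [if_neg (by omega)]
      -- either the tag is after `t`, or the interval is degenerate
      rcases (hti.trans hii).eq_or_lt with h | h
      · have h' : gridPt t N i = gridPt t N (i + 1) := le_antisymm hii (h ▸ hti)
        rw [h', sub_self, smul_zero]
      · rw [hft _ h, zero_smul]
    rw [hz, add_zero]
    exact Finset.sum_congr rfl fun i hi => by rw [if_pos (Finset.mem_range.1 hi)]
  rwa [h2] at h1

/-- The norm of a represented element is estimated by tagged sums over grids of `[0, t]`. -/
theorem Represents.norm_le (ho : (o : ℝ) = 0) (he : (e : ℝ) = T) {f : Icc (0 : ℝ) T → ℝ}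
    {h : WienerSpace K hK} (hh : Represents o e f h) {t : Icc (0 : ℝ) T}
    (hft : ∀ s, t < s → f s = 0) {B : ℝ}
    (hB : ∀ N : ℕ, 0 < N → ‖∑ i ∈ Finset.range N, f (gridPt t N (i + 1)) •
      (StepFun.ind K hK (gridPt t N (i + 1)) - StepFun.ind K hK (gridPt t N i))‖ ≤ B) :
    ‖h‖ ≤ B := by
  refine le_of_forall_pos_le_add fun ε hε => ?_
  obtain ⟨N, hN, h1⟩ := hh.exists_grid ho he hft hε
  have h2 := h1 (fun i => gridPt t N (i + 1))
    fun i _ => ⟨monotone_gridPt t N (Nat.le_succ i), le_rfl⟩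
  have h3 := hB N hN
  rw [← UniformSpace.Completion.norm_coe] at h3
  rw [norm_sub_rev] at h2
  have h4 := norm_le_norm_add_norm_sub' h
    ((∑ i ∈ Finset.range N, f (gridPt t N (i + 1)) • (StepFun.ind K hK (gridPt t N (i + 1)) -
        StepFun.ind K hK (gridPt t N i)) : StepFun K hK) : WienerSpace K hK)
  linarith

theorem gridPt_mem_Icc (ho : (o : ℝ) = 0) {t : Icc (0 : ℝ) T} {N k : ℕ} (hN : 0 < N) (hk : k ≤ N) :
    gridPt t N k ∈ Icc o t := by
  refine ⟨Subtype.coe_le_coe.1 (by rw [ho]; exact (gridPt t N k).2.1), ?_⟩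
  conv_rhs => rw [← gridPt_self (t := t) hN]
  exact monotone_gridPt t N hk

theorem Represents.norm_le_of_variationLE (ho : (o : ℝ) = 0) (he : (e : ℝ) = T)
    {f : Icc (0 : ℝ) T → ℝ} {h : WienerSpace K hK} (hh : Represents o e f h) {t : Icc (0 : ℝ) T}
    (hft : ∀ s, t < s → f s = 0) {ρ q p V A M : ℝ} (hρ : 1 ≤ ρ)
    (hq : q = (1 / (2 * ρ) + 1 / 2)⁻¹) (hp : 0 < p) (hpq : 1 < 1 / p + 1 / q) (hV : 0 ≤ V)
    (hKV : MixedVariationLE ρ V K (Icc o t)) (hA : 0 ≤ A)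
    (hf : VariationLE p A f (Icc o t)) (hM : ∀ s, |f s| ≤ M) :
    ‖h‖ ≤ (M + youngConst (1 / p + 1 / q) * A) * √V := by
  refine hh.norm_le ho he hft fun N hN => ?_
  have := StepFun.norm_sum_le (hK := hK) (x := fun k => gridPt t N (min k N))
    (ξ := fun k => gridPt t N (min (k + 1) N)) hρ hq hp hpq hV hKV hA hf
    (fun k l hkl => monotone_gridPt t N (by omega))
    (fun k => gridPt_mem_Icc ho hN (min_le_right _ _))
    (fun k l hkl => monotone_gridPt t N (by omega))
    (fun k => gridPt_mem_Icc ho hN (min_le_right _ _)) (hM _) N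
  refine le_trans (le_of_eq (congrArg _ (Finset.sum_congr rfl fun i hi => ?_))) this
  have hi' := Finset.mem_range.1 hi
  rw [min_eq_left hi'.le, min_eq_left (show i + 1 ≤ N from hi')]

/-- The degenerate case: if the covariance has no variation on `[0, t]`, then all functions supported
in `[0, t]` define the zero element, whether or not they are of finite variation. -/
theorem Represents.norm_eq_zero (ho : (o : ℝ) = 0) (he : (e : ℝ) = T)
    {f : Icc (0 : ℝ) T → ℝ} {h : WienerSpace K hK} (hh : Represents o e f h) {t : Icc (0 : ℝ) T}
    (hft : ∀ s, t < s → f s = 0) {ρ : ℝ} (hρ : 0 < ρ)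
    (hKV : MixedVariationLE ρ 0 K (Icc o t)) : ‖h‖ = 0 := by
  refine le_antisymm (hh.norm_le ho he hft fun N hN => ?_) (norm_nonneg _)
  refine (norm_sum_le _ _).trans (Finset.sum_nonpos fun i hi => ?_)
  have hi' := Finset.mem_range.1 hi
  set u := gridPt t N i with hu
  set v := gridPt t N (i + 1) with hv
  have huv : u ≤ v := monotone_gridPt t N (Nat.le_succ i)
  have h1 := hKV (fun k => if k = 0 then u else v) (by
    refine monotone_nat_of_le_succ fun k => ?_
    by_cases hk : k = 0 <;> simp [hk, huv]) (fun k => by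
      by_cases hk : k = 0
      · simpa [hk] using gridPt_mem_Icc ho hN hi'.le
      · simpa [hk] using gridPt_mem_Icc ho hN hi') 1
  simp only [Finset.range_one, Finset.sum_singleton, zero_add, one_ne_zero, if_false,
    if_true, Real.zero_rpow hρ.ne'] at h1
  have h2 : |rectIncr K u v u v| = 0 := by
    by_contra hne
    have : 0 < |rectIncr K u v u v| := lt_of_le_of_ne (abs_nonneg _) (Ne.symm hne)
    exact absurd (Real.rpow_pos_of_pos this ρ) (not_lt.2 h1)
  rw [abs_eq_zero, ← StepFun.inner_ind_sub_ind (hK := hK), real_inner_self_eq_norm_sq] at h2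
  rw [norm_smul, (pow_eq_zero_iff two_ne_zero).1 h2, mul_zero]

end Represents

/-! ### Mean-square continuity of Gaussian processes -/

namespace IsCenteredGaussianIID

variable {Ω : Type*} [MeasurableSpace Ω] {P : Measure Ω} {d : ℕ} {ι : Type*}

/-- The variance of an increment, as a rectangular increment of the covariance. -/
theorem rectIncr_covKernel [TopologicalSpace ι] {X : ι → Ω → Fin d → ℝ}
    (hX : IsCenteredGaussianIID X P) (j : Fin d) (s t : ι) :
    rectIncr (covKernel X P j) s t s t = ∫ ω, (X t ω j - X s ω j) ^ 2 ∂P := by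
  have hint : ∀ s t, Integrable (fun ω => X s ω j * X t ω j) P := fun s t =>
    (hX.memLp s j).integrable_mul (hX.memLp t j)
  simp only [rectIncr, covKernel, Matrix.of_apply]
  rw [← integral_sub' (hint _ _) (hint _ _), ← integral_sub' ((hint _ _).sub (hint _ _)) (hint _ _),
    ← integral_add' (((hint _ _).sub (hint _ _)).sub (hint _ _)) (hint _ _)]
  refine integral_congr_ae (ae_of_all _ fun ω => ?_)
  simp only [Pi.sub_apply, Pi.add_apply]
  ring

/-- The characteristic function of a Gaussian increment. -/
theorem integral_cos_sub [TopologicalSpace ι] {X : ι → Ω → Fin d → ℝ}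
    (hX : IsCenteredGaussianIID X P) (j : Fin d) (s t : ι) :
    ∫ ω, Real.cos (X t ω j - X s ω j) ∂P =
      Real.exp (-(∫ ω, (X t ω j - X s ω j) ^ 2 ∂P) / 2) := by
  have hg : HasGaussianLaw (fun ω => X t ω j - X s ω j) P :=
    (hX.gaussian.hasGaussianLaw_sub (s := t) (t := s)).map_fun (.proj j)
  have : IsProbabilityMeasure P := hg.isProbabilityMeasure
  have hm : ∫ ω, (X t ω j - X s ω j) ∂P = 0 := by
    rw [integral_sub ((hX.memLp t j).integrable (by norm_num))
      ((hX.memLp s j).integrable (by norm_num)), hX.centered, hX.centered, sub_zero]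
  have hv : Var[fun ω => X t ω j - X s ω j; P] = ∫ ω, (X t ω j - X s ω j) ^ 2 ∂P :=
    variance_of_integral_eq_zero hg.aemeasurable hm
  have h := hg.charFun_map_eq (1 : ℝ)
  rw [charFun_apply_real, integral_map hg.aemeasurable (by fun_prop)] at h
  have h2 := congrArg Complex.re h
  have hre : (∫ ω, Complex.exp (((1 : ℝ) : ℂ) * ((X t ω j - X s ω j : ℝ) : ℂ) * Complex.I) ∂P).re =
      ∫ ω, Real.cos (X t ω j - X s ω j) ∂P := by
    have hi : Integrable (fun ω => Complex.exp (((1 : ℝ) : ℂ) * ((X t ω j - X s ω j : ℝ) : ℂ) *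
        Complex.I)) P := by
      refine Integrable.of_bound (C := 1) ?_ (ae_of_all _ fun ω => ?_)
      · have := hg.aemeasurable
        exact (Complex.measurable_exp.comp_aemeasurable
          (((Complex.measurable_ofReal.comp_aemeasurable this).const_mul _).mul_const
            _)).aestronglyMeasurable
      · rw [← Complex.ofReal_mul, Complex.norm_exp_ofReal_mul_I]
    have := integral_re hi
    simp only [RCLike.re_to_complex] at this
    rw [← this]
    refine integral_congr_ae (ae_of_all _ fun ω => ?_)
    simp only [Complex.ofReal_one, one_mul, Complex.exp_ofReal_mul_I_re]
  rw [hre] at h2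
  rw [h2]
  simp only [RCLike.inner_apply, conj_trivial, mul_one, hm, hv]
  rw [Complex.ofReal_zero, zero_mul, zero_sub, ← Complex.ofReal_ofNat, ← Complex.ofReal_div,
    ← Complex.ofReal_neg, Complex.exp_ofReal_re, neg_div]

/-- The map `t ↦ 1_{[0, t]}` is continuous: by dominated convergence, the characteristic function of
the increments tends to `1`, so that their variance tends to `0`. -/
theorem continuous_ind [TopologicalSpace ι] [FirstCountableTopology ι] {X : ι → Ω → Fin d → ℝ}
    (hX : IsCenteredGaussianIID X P) (j : Fin d) :
    Continuous (StepFun.ind (covKernel X P j) (hX.posSemidef j)) := by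
  refine continuous_iff_continuousAt.2 fun s => tendsto_iff_norm_sub_tendsto_zero.2 ?_
  have : IsProbabilityMeasure P := (hX.gaussian.hasGaussianLaw_eval s).isProbabilityMeasure
  have hcos : Tendsto (fun t => ∫ ω, Real.cos (X t ω j - X s ω j) ∂P) (𝓝 s)
      (𝓝 (∫ _, (1 : ℝ) ∂P)) := by
    refine tendsto_integral_filter_of_dominated_convergence (fun _ => 1) ?_ ?_
      (integrable_const _) ?_
    · refine Eventually.of_forall fun t => ?_
      have h1 := (measurable_pi_iff.1 (hX.measurable t) j).sub
        (measurable_pi_iff.1 (hX.measurable s) j)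
      exact (Real.measurable_cos.comp h1).aestronglyMeasurable
    · exact Eventually.of_forall fun t => ae_of_all _ fun ω => Real.abs_cos_le_one _
    · filter_upwards [hX.continuous] with ω hω
      have h1 : Continuous fun t => Real.cos (X t ω j - X s ω j) :=
        Real.continuous_cos.comp (((continuous_apply j).comp hω).sub continuous_const)
      simpa using h1.tendsto s
  have hv : ∀ t, ‖StepFun.ind (covKernel X P j) (hX.posSemidef j) t -
      StepFun.ind (covKernel X P j) (hX.posSemidef j) s‖ =
      √(-2 * Real.log (∫ ω, Real.cos (X t ω j - X s ω j) ∂P)) := by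
    intro t
    rw [hX.integral_cos_sub, Real.log_exp, ← hX.rectIncr_covKernel,
      ← StepFun.inner_ind_sub_ind (hK := hX.posSemidef j), real_inner_self_eq_norm_sq,
      show ∀ x : ℝ, -2 * (-x / 2) = x by intro x; ring, Real.sqrt_sq (norm_nonneg _)]
  simp only [hv]
  rw [integral_const, probReal_univ, smul_eq_mul, mul_one] at hcos
  have h1 := (hcos.log one_ne_zero).const_mul (-2)
  rw [Real.log_one, mul_zero] at h1
  simpa using h1.sqrt

end IsCenteredGaussianIID

/-! ### Variation of Hölder functions cut off at a point -/

section Holder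

variable {α : Type*} [LinearOrder α]

/-- A single jump has `p`-variation equal to its size. -/
theorem variationLE_indicator_Ioi {p : ℝ} (hp : 0 < p) (t : α) (c : ℝ) :
    VariationLE p |c| ((Ioi t).indicator fun _ => c) univ := by
  intro x hx _ m
  set u : ℕ → ℝ := fun k => (Ioi t).indicator (fun _ => (1 : ℝ)) (x k) with hu
  have hu01 : ∀ k, u k = 0 ∨ u k = 1 := fun k => by
    by_cases h : x k ∈ Ioi t <;> simp [hu, h]
  have hcu : ∀ k, (Ioi t).indicator (fun _ => c) (x k) = c * u k := fun k => by
    by_cases h : x k ∈ Ioi t <;> simp [hu, h]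
  have hmono : ∀ k, u k ≤ u (k + 1) := by
    intro k
    by_cases h : x k ∈ Ioi t
    · have h' : x (k + 1) ∈ Ioi t := lt_of_lt_of_le h (hx (Nat.le_succ k))
      simp [hu, h, h']
    · have : u k = 0 := by simp [hu, h]
      rw [this]
      rcases hu01 (k + 1) with h1 | h1 <;> simp [h1]
  have key : ∀ k, |c * u (k + 1) - c * u k| ^ p ≤ |c| ^ p * (u (k + 1) - u k) := by
    intro k
    rw [← mul_sub, abs_mul, Real.mul_rpow (abs_nonneg _) (abs_nonneg _)]
    have := hmono k
    rcases hu01 (k + 1) with h1 | h1 <;> rcases hu01 k with h2 | h2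
    · simp [h1, h2, Real.zero_rpow hp.ne']
    · linarith
    · simp [h1, h2]
    · simp [h1, h2, Real.zero_rpow hp.ne']
  simp only [hcu]
  refine (Finset.sum_le_sum fun k _ => key k).trans ?_
  rw [← Finset.mul_sum, Finset.sum_range_sub]
  refine mul_le_of_le_one_right (by positivity) ?_
  rcases hu01 m with h1 | h1 <;> rcases hu01 0 with h2 | h2 <;> rw [h1, h2] <;> norm_num

/-- Restriction to `[a, t]` preserves finite `p`-variation: it is stopping at `t`, followed by a
jump to `0` after `t`. -/
theorem VariationLE.indicator_Icc {p A : ℝ} (hp : 1 ≤ p) (hA : 0 ≤ A) {f : α → ℝ}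
    (hf : VariationLE p A f univ) {a : α} (ha : ∀ s, a ≤ s) (t : α) :
    VariationLE p (4 * max A |f t|) ((Icc a t).indicator f) univ := by
  have hp0 : 0 ≤ p := by linarith
  have h1 : VariationLE p (max A |f t|) (fun s => f (min s t)) univ :=
    (hf.comp (φ := fun s => min s t) (fun x y hxy => min_le_min_right t hxy)
      fun _ _ => mem_univ _).mono_bound hp0 hA (le_max_left _ _)
  have h2 : VariationLE p (max A |f t|) ((Ioi t).indicator fun _ => f t) univ :=
    (variationLE_indicator_Ioi (by linarith) t (f t)).mono_bound hp0 (abs_nonneg _)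
      (le_max_right _ _)
  have h3 := h1.sub h2 hp (hA.trans (le_max_left _ _))
  have e : (Icc a t).indicator f = fun s => f (min s t) - (Ioi t).indicator (fun _ => f t) s := by
    funext s
    rcases le_or_gt s t with h | h
    · rw [indicator_of_mem (show s ∈ Icc a t from ⟨ha s, h⟩),
        indicator_of_notMem (show s ∉ Ioi t from not_lt.2 h), min_eq_left h, sub_zero]
    · rw [indicator_of_notMem (fun hs => absurd hs.2 (not_le.2 h)), indicator_of_mem (mem_Ioi.2 h),
        min_eq_right h.le, sub_self]
  rw [e]; exact h3

/-- A `g`-Hölder function has finite `1 / g`-variation. -/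
theorem HolderWith.variationLE {T : ℝ} (hT : 0 ≤ T) {C g : ℝ≥0} (hg : 0 < g)
    {f : Icc (0 : ℝ) T → ℝ} (hf : HolderWith C g f) :
    VariationLE (1 / (g : ℝ)) (C * T ^ (g : ℝ)) f univ := by
  intro x hx _ m
  have hg' : (0 : ℝ) < g := hg
  have key : ∀ k, |f (x (k + 1)) - f (x k)| ^ (1 / (g : ℝ)) ≤
      (C : ℝ) ^ (1 / (g : ℝ)) * ((x (k + 1) : ℝ) - x k) := by
    intro k
    have h0 : 0 ≤ (x (k + 1) : ℝ) - x k := sub_nonneg.2 (hx (Nat.le_succ k))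
    have h1 := hf.dist_le (x (k + 1)) (x k)
    rw [Real.dist_eq, Subtype.dist_eq, Real.dist_eq, abs_of_nonneg h0] at h1
    refine (Real.rpow_le_rpow (abs_nonneg _) h1 (by positivity)).trans_eq ?_
    rw [Real.mul_rpow C.coe_nonneg (by positivity), ← Real.rpow_mul h0, mul_one_div_cancel hg'.ne',
      Real.rpow_one]
  refine (Finset.sum_le_sum fun k _ => key k).trans ?_
  rw [← Finset.mul_sum, Finset.sum_range_sub (fun k => (x k : ℝ)),
    Real.mul_rpow C.coe_nonneg (by positivity),
    ← Real.rpow_mul hT, mul_one_div_cancel hg'.ne', Real.rpow_one]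
  refine mul_le_mul_of_nonneg_left ?_ (by positivity)
  linarith [(x m).2.2, (x 0).2.1]

end Holder

/-! ### The increment measure and the lower bound -/

/-- Diagonal dominance of a family with non-positive off-diagonal Gram matrix:
`cᵢ cⱼ ⟪xᵢ, xⱼ⟫ ≥ (cᵢ² + cⱼ²) / 2 * ⟪xᵢ, xⱼ⟫` for all `i`, `j`. -/
theorem sum_sq_mul_inner_sum_le {E : Type*} [SeminormedAddCommGroup E] [InnerProductSpace ℝ E]
    (x : ℕ → E) (c : ℕ → ℝ) (n : ℕ)
    (hx : ∀ i j, i < n → j < n → i ≠ j → (inner ℝ (x i) (x j) : ℝ) ≤ 0) :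
    ∑ i ∈ Finset.range n, c i ^ 2 * inner ℝ (x i) (∑ j ∈ Finset.range n, x j) ≤
      ‖∑ i ∈ Finset.range n, c i • x i‖ ^ 2 := by
  have e : ‖∑ i ∈ Finset.range n, c i • x i‖ ^ 2 =
      ∑ i ∈ Finset.range n, ∑ j ∈ Finset.range n, c i * (c j * inner ℝ (x i) (x j)) := by
    rw [← real_inner_self_eq_norm_sq, sum_inner]
    refine Finset.sum_congr rfl fun i _ => ?_
    rw [inner_sum]
    refine Finset.sum_congr rfl fun j _ => ?_
    rw [inner_smul_left, inner_smul_right]; simp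
  have e1 : ∑ i ∈ Finset.range n, c i ^ 2 * inner ℝ (x i) (∑ j ∈ Finset.range n, x j) =
      ∑ i ∈ Finset.range n, ∑ j ∈ Finset.range n, c i ^ 2 * inner ℝ (x i) (x j) := by
    refine Finset.sum_congr rfl fun i _ => ?_
    rw [inner_sum, Finset.mul_sum]
  have e2 : ∑ i ∈ Finset.range n, ∑ j ∈ Finset.range n, c j ^ 2 * inner ℝ (x i) (x j) =
      ∑ i ∈ Finset.range n, ∑ j ∈ Finset.range n, c i ^ 2 * inner ℝ (x i) (x j) := by
    rw [Finset.sum_comm]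
    refine Finset.sum_congr rfl fun j _ => Finset.sum_congr rfl fun i _ => ?_
    rw [real_inner_comm]
  have e3 : ∑ i ∈ Finset.range n, ∑ j ∈ Finset.range n,
      (c i ^ 2 * inner ℝ (x i) (x j) + c j ^ 2 * inner ℝ (x i) (x j)) / 2 ≤
      ∑ i ∈ Finset.range n, ∑ j ∈ Finset.range n, c i * (c j * inner ℝ (x i) (x j)) := by
    refine Finset.sum_le_sum fun i hi => Finset.sum_le_sum fun j hj => ?_
    rcases eq_or_ne i j with rfl | hij
    · exact le_of_eq (by ring)
    · have := hx i j (Finset.mem_range.1 hi) (Finset.mem_range.1 hj) hij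
      nlinarith [mul_nonneg (sq_nonneg (c i - c j)) (neg_nonneg.2 this)]
  rw [e, e1]
  refine le_trans (le_of_eq ?_) e3
  simp only [← Finset.sum_div, Finset.sum_add_distrib]
  rw [e2]; ring

section Lower

variable {T : ℝ} {K : Matrix (Icc (0 : ℝ) T) (Icc (0 : ℝ) T) ℝ} {hK : K.PosSemidef}
  {o e : Icc (0 : ℝ) T}

theorem continuous_rectIncr (hcont : Continuous (StepFun.ind K hK)) {β : Type*}
    [TopologicalSpace β] {a b c d : β → Icc (0 : ℝ) T} (ha : Continuous a) (hb : Continuous b)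
    (hc : Continuous c) (hd : Continuous d) :
    Continuous fun x => rectIncr K (a x) (b x) (c x) (d x) := by
  simp only [← StepFun.inner_ind_sub_ind (hK := hK)]
  exact ((hcont.comp hb).sub (hcont.comp ha)).inner ((hcont.comp hd).sub (hcont.comp hc))

/-- By continuity, increments over adjacent intervals are non-positively correlated too. -/
theorem NonposCorrelated.rectIncr_nonpos (hcont : Continuous (StepFun.ind K hK))
    (hneg : NonposCorrelated K) {s t u v : Icc (0 : ℝ) T} (hst : s ≤ t) (htu : t ≤ u)
    (huv : u ≤ v) : rectIncr K s t u v ≤ 0 := by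
  rcases hst.eq_or_lt with rfl | hst'
  · simp [rectIncr]
  rcases huv.eq_or_lt with rfl | huv'
  · simp [rectIncr]
  have : (𝓝[<] t).NeBot := nhdsLT_neBot_of_exists_lt ⟨s, hst'⟩
  have hlim : Tendsto (fun t' => rectIncr K s t' u v) (𝓝[<] t) (𝓝 (rectIncr K s t u v)) :=
    ((continuous_rectIncr hcont continuous_const continuous_id continuous_const
      continuous_const).tendsto t).mono_left nhdsWithin_le_nhds
  refine le_of_tendsto hlim ?_
  filter_upwards [Ioo_mem_nhdsLT hst'] with t' ht'
  exact hneg s t' u v ht'.1 (ht'.2.trans_le htu) huv'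

/-- By continuity, the interval in the middle may share its end points with the larger one. -/
theorem DiagDominant.rectIncr_nonneg (hcont : Continuous (StepFun.ind K hK))
    (hdd : DiagDominant K) {s u v t : Icc (0 : ℝ) T} (hsu : s ≤ u) (huv : u ≤ v) (hvt : v ≤ t) :
    0 ≤ rectIncr K u v s t := by
  rcases huv.eq_or_lt with rfl | huv'
  · simp [rectIncr]
  have hright : ∀ u v : Icc (0 : ℝ) T, s ≤ u → u < v → v < t → 0 ≤ rectIncr K u v s t := by
    intro u v hsu huv hvt
    have : (𝓝[>] u).NeBot := nhdsGT_neBot_of_exists_gt ⟨v, huv⟩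
    have hlim : Tendsto (fun u' => rectIncr K u' v s t) (𝓝[>] u) (𝓝 (rectIncr K u v s t)) :=
      ((continuous_rectIncr hcont continuous_id continuous_const continuous_const
        continuous_const).tendsto u).mono_left nhdsWithin_le_nhds
    refine ge_of_tendsto hlim ?_
    filter_upwards [Ioo_mem_nhdsGT huv] with u' hu'
    exact hdd s u' v t (hsu.trans_lt hu'.1) hu'.2 hvt
  have : (𝓝[<] v).NeBot := nhdsLT_neBot_of_exists_lt ⟨u, huv'⟩
  have hlim : Tendsto (fun v' => rectIncr K u v' s t) (𝓝[<] v) (𝓝 (rectIncr K u v s t)) :=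
    ((continuous_rectIncr hcont continuous_const continuous_id continuous_const
      continuous_const).tendsto v).mono_left nhdsWithin_le_nhds
  refine ge_of_tendsto hlim ?_
  filter_upwards [Ioo_mem_nhdsLT huv'] with v' hv'
  exact hright u v' hsu hv'.1 (hv'.2.trans_le hvt)

/-- The increment measure is the Stieltjes measure of `s ↦ R([0, s ∧ t] × [0, t])`. -/
theorem exists_isIncrMeasure (hcont : Continuous (StepFun.ind K hK)) (ho : (o : ℝ) = 0)
    (hdd : DiagDominant K) (t : Icc (0 : ℝ) T) : ∃ ν : Measure (Icc (0 : ℝ) T),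
      IsIncrMeasure K o t ν := by
  have hbot : ∀ s : Icc (0 : ℝ) T, o ≤ s := fun s => Subtype.coe_le_coe.1 (by rw [ho]; exact s.2.1)
  have hadd : ∀ u v, rectIncr K o v o t - rectIncr K o u o t = rectIncr K u v o t := by
    intro u v; simp only [rectIncr]; ring
  have hF : Continuous fun s => rectIncr K o (min s t) o t :=
    continuous_rectIncr hcont continuous_const (continuous_id.min continuous_const)
      continuous_const continuous_const
  have : CompactIccSpace (Icc (0 : ℝ) T) := ⟨fun {_ _} => isClosed_Icc.isCompact⟩
  let G : StieltjesFunction (Icc (0 : ℝ) T) :=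
    { toFun := fun s => rectIncr K o (min s t) o t
      mono' := fun u v huv => by
        have := hdd.rectIncr_nonneg hcont (hbot (min u t)) (min_le_min_right t huv)
          (min_le_right v t)
        rw [← hadd] at this
        exact sub_nonneg.1 this
      right_continuous' := fun s => hF.continuousWithinAt }
  have hG : ∀ s, G s = rectIncr K o (min s t) o t := fun s => rfl
  refine ⟨G.measure, fun u v hu huv hvt => ⟨hdd.rectIncr_nonneg hcont hu huv hvt, ?_⟩, ?_⟩
  · have hleft : Function.leftLim G u = G u :=
      ContinuousWithinAt.leftLim_eq (f := G) hF.continuousWithinAt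
    rw [StieltjesFunction.measure_Icc, hleft, hG, hG, min_eq_left hvt,
      min_eq_left (huv.trans hvt), hadd]
  · have hsub : (Icc o t)ᶜ ⊆ Ioc t (⟨T, ⟨t.2.1.trans t.2.2, le_rfl⟩⟩ : Icc (0 : ℝ) T) := by
      intro s hs
      refine ⟨not_le.1 fun h => hs ⟨hbot s, h⟩, s.2.2⟩
    refine measure_mono_null hsub ?_
    rw [StieltjesFunction.measure_Ioc, hG, hG, min_self, min_eq_right (show t ≤ _ from t.2.2), sub_self,
      ENNReal.ofReal_zero]

theorem IsIncrMeasure.isFiniteMeasure {t : Icc (0 : ℝ) T} {ν : Measure (Icc (0 : ℝ) T)}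
    (hν : IsIncrMeasure K o t ν) (hot : o ≤ t) : IsFiniteMeasure ν := by
  refine ⟨?_⟩
  rw [← union_compl_self (Icc o t)]
  refine (measure_union_le _ _).trans_lt ?_
  rw [hν.2, add_zero, (hν.1 o t le_rfl hot le_rfl).2]
  exact ENNReal.ofReal_lt_top

theorem IsIncrMeasure.measureReal_Icc {t u v : Icc (0 : ℝ) T} {ν : Measure (Icc (0 : ℝ) T)}
    (hν : IsIncrMeasure K o t ν) (hu : o ≤ u) (huv : u ≤ v) (hvt : v ≤ t) :
    ν.real (Icc u v) = rectIncr K u v o t := by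
  have h := hν.1 u v hu huv hvt
  rw [measureReal_def, h.2, ENNReal.toReal_ofReal h.1]

/-- The integral of `f ^ 2` is at most its upper Darboux sum on a grid. -/
theorem IsIncrMeasure.setIntegral_sq_le {t : Icc (0 : ℝ) T} {ν : Measure (Icc (0 : ℝ) T)}
    (hν : IsIncrMeasure K o t ν) {f : Icc (0 : ℝ) T → ℝ} (hf : Continuous f)
    {x ξ : ℕ → Icc (0 : ℝ) T} (hx : Monotone x) (hx0 : x 0 = o) {N : ℕ} (hxN : x N = t)
    (hξ : ∀ i < N, ∀ s ∈ Icc (x i) (x (i + 1)), f s ^ 2 ≤ f (ξ i) ^ 2) :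
    ∫ s in Icc o t, f s ^ 2 ∂ν ≤
      ∑ i ∈ Finset.range N, f (ξ i) ^ 2 * rectIncr K (x i) (x (i + 1)) o t := by
  have hot : o ≤ t := by rw [← hx0, ← hxN]; exact hx (Nat.zero_le N)
  have := hν.isFiniteMeasure hot
  have hint : ∀ S : Set (Icc (0 : ℝ) T), IntegrableOn (fun s => f s ^ 2) S ν := fun S =>
    ((hf.pow 2).continuousOn.integrableOn_compact isCompact_univ).mono_set (subset_univ S)
  have hox : ∀ i, o ≤ x i := fun i => hx0 ▸ hx (Nat.zero_le i)
  have key : ∀ k ≤ N, ∫ s in Icc o (x k), f s ^ 2 ∂ν ≤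
      ∑ i ∈ Finset.range k, f (ξ i) ^ 2 * rectIncr K (x i) (x (i + 1)) o t := by
    intro k
    induction k with
    | zero =>
      intro _
      have : ν (Icc o o) = 0 := by
        rw [(hν.1 o o le_rfl le_rfl hot).2]; simp [rectIncr]
      rw [hx0, setIntegral_measure_zero _ this]; simp
    | succ k ih =>
      intro hk
      have hxk : x k ≤ x (k + 1) := hx (Nat.le_succ k)
      have hxt : x (k + 1) ≤ t := hxN ▸ hx hk
      rw [Finset.sum_range_succ, ← Icc_union_Ioc_eq_Icc (hox k) hxk,
        setIntegral_union (disjoint_left.2 fun s h1 h2 => absurd h1.2 (not_le.2 h2.1))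
          measurableSet_Ioc (hint _) (hint _)]
      refine add_le_add (ih (by omega)) ?_
      calc ∫ s in Ioc (x k) (x (k + 1)), f s ^ 2 ∂ν
          ≤ ∫ _ in Ioc (x k) (x (k + 1)), f (ξ k) ^ 2 ∂ν :=
            setIntegral_mono_on (hint _) (integrable_const _) measurableSet_Ioc
              fun s hs => hξ k (by omega) s (Ioc_subset_Icc_self hs)
        _ = f (ξ k) ^ 2 * ν.real (Ioc (x k) (x (k + 1))) := by
            rw [setIntegral_const, smul_eq_mul, mul_comm]
        _ ≤ f (ξ k) ^ 2 * ν.real (Icc (x k) (x (k + 1))) :=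
            mul_le_mul_of_nonneg_left (measureReal_mono Ioc_subset_Icc_self) (sq_nonneg _)
        _ = _ := by rw [hν.measureReal_Icc (hox k) hxk hxt]
  rw [← hxN]
  simpa only [hxN] using key N le_rfl

/-- The lower bound by the integral against the increment measure. On each interval of a grid the
tag is chosen to maximize `f ^ 2`. -/
theorem Represents.setIntegral_sq_le (hcont : Continuous (StepFun.ind K hK)) (ho : (o : ℝ) = 0)
    (he : (e : ℝ) = T) (hneg : NonposCorrelated K) {t : Icc (0 : ℝ) T}
    {ν : Measure (Icc (0 : ℝ) T)} (hν : IsIncrMeasure K o t ν) {f : Icc (0 : ℝ) T → ℝ}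
    (hf : Continuous f) {h : WienerSpace K hK} (hh : Represents o e ((Icc o t).indicator f) h) :
    ∫ s in Icc o t, f s ^ 2 ∂ν ≤ ‖h‖ ^ 2 := by
  set I := ∫ s in Icc o t, f s ^ 2 ∂ν with hI
  suffices hs : √I ≤ ‖h‖ from (Real.sqrt_le_left (norm_nonneg _)).1 hs
  refine le_of_forall_pos_le_add fun ε hε => ?_
  obtain ⟨N, hN, h1⟩ := hh.exists_grid ho he
    (fun s hs => indicator_of_notMem (fun h => absurd h.2 (not_le.2 hs)) f) hε
  have hmono := monotone_gridPt t N
  have hmax : ∀ i, ∃ ξ ∈ Icc (gridPt t N i) (gridPt t N (i + 1)),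
      ∀ s ∈ Icc (gridPt t N i) (gridPt t N (i + 1)), f s ^ 2 ≤ f ξ ^ 2 := fun i =>
    isClosed_Icc.isCompact.exists_isMaxOn ⟨_, le_rfl, hmono (Nat.le_succ i)⟩ (hf.pow 2).continuousOn
  choose ξ hξ hξmax using hmax
  have h2 := h1 ξ fun i _ => hξ i
  set x : ℕ → StepFun K hK := fun i =>
    StepFun.ind K hK (gridPt t N (i + 1)) - StepFun.ind K hK (gridPt t N i) with hx
  have h0 : gridPt t N 0 = o := Subtype.ext (by rw [coe_gridPt_zero, ho])
  have hsum : ∑ i ∈ Finset.range N, x i = StepFun.ind K hK t - StepFun.ind K hK o := by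
    rw [hx, Finset.sum_range_sub (fun i => StepFun.ind K hK (gridPt t N i)), gridPt_self hN, h0]
  have hoff : ∀ i j, i < j → (inner ℝ (x i) (x j) : ℝ) ≤ 0 := fun i j hij => by
    rw [hx]
    simp only [StepFun.inner_ind_sub_ind]
    exact hneg.rectIncr_nonpos hcont (hmono (Nat.le_succ i)) (hmono hij) (hmono (Nat.le_succ j))
  have h3 := sum_sq_mul_inner_sum_le x (fun i => (Icc o t).indicator f (ξ i)) N
    fun i j _ _ hij => by
      rcases lt_or_gt_of_ne hij with hlt | hlt
      · exact hoff i j hlt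
      · rw [real_inner_comm]; exact hoff j i hlt
  have h4 := hν.setIntegral_sq_le hf hmono h0 (gridPt_self hN) (fun i _ => hξmax i)
  have h5 : I ≤ ‖∑ i ∈ Finset.range N, (Icc o t).indicator f (ξ i) • x i‖ ^ 2 := by
    refine h4.trans (le_trans (le_of_eq (Finset.sum_congr rfl fun i hi => ?_)) h3)
    have hi' := Finset.mem_range.1 hi
    have hmem : ξ i ∈ Icc o t :=
      ⟨(gridPt_mem_Icc ho hN hi'.le).1.trans (hξ i).1, (hξ i).2.trans (gridPt_mem_Icc ho hN hi').2⟩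
    rw [hsum, indicator_of_mem hmem, StepFun.inner_ind_sub_ind]
  have h6 : √I ≤ ‖∑ i ∈ Finset.range N, (Icc o t).indicator f (ξ i) • x i‖ :=
    (Real.sqrt_le_left (norm_nonneg _)).2 h5
  rw [← UniformSpace.Completion.norm_coe] at h6
  have h7 := norm_le_norm_add_norm_sub'
    ((∑ i ∈ Finset.range N, (Icc o t).indicator f (ξ i) • x i : StepFun K hK) : WienerSpace K hK) h
  linarith

/-- A function is at least its infimum on `[o, t]`, integrated against the increment measure. -/
theorem IsIncrMeasure.mul_sInf_le {t : Icc (0 : ℝ) T} {ν : Measure (Icc (0 : ℝ) T)}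
    (hν : IsIncrMeasure K o t ν) (hot : o ≤ t) {f : Icc (0 : ℝ) T → ℝ} (hf : Continuous f) :
    rectIncr K o t o t * sInf ((fun r => |f r| ^ 2) '' Icc o t) ≤
      ∫ r in Icc o t, f r ^ 2 ∂ν := by
  have := hν.isFiniteMeasure hot
  rw [← hν.measureReal_Icc le_rfl hot le_rfl, ← smul_eq_mul, ← setIntegral_const]
  refine setIntegral_mono_on (integrable_const _)
    (((hf.pow 2).continuousOn.integrableOn_compact isCompact_univ).mono_set (subset_univ _))
    measurableSet_Icc fun s hs => ?_
  rw [← sq_abs (f s)]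
  exact csInf_le ⟨0, by rintro _ ⟨r, _, rfl⟩; positivity⟩ ⟨s, hs, rfl⟩

end Lower

theorem IsCenteredGaussianIID.rectIncr_eq_sigmaSq {Ω : Type*} [MeasurableSpace Ω] {P : Measure Ω}
    {d : ℕ} {ι : Type*} [TopologicalSpace ι] {X : ι → Ω → Fin d → ℝ}
    (hX : IsCenteredGaussianIID X P) (j : Fin d) {o : ι} (h0 : ∀ᵐ ω ∂P, X o ω = 0) (t : ι) :
    rectIncr (covKernel X P j) o t o t = sigmaSq X P j t := by
  rw [hX.rectIncr_covKernel, sigmaSq]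
  refine integral_congr_ae ?_
  filter_upwards [h0] with ω hω
  simp [hω]

end

/-! ### Bounds for the norm of `f 1_{[0, t]}` -/

theorem abs_le_toReal_supNorm {α : Type*} {f : α → ℝ} (hf : supNorm f ≠ ∞) (s : α) :
    |f s| ≤ (supNorm f).toReal := by
  have h : ‖f s‖ₑ ≤ supNorm f := le_iSup (fun s => ‖f s‖ₑ) s
  rw [Real.enorm_eq_ofReal_abs] at h
  exact (ENNReal.ofReal_le_iff_le_toReal hf).1 h

/-- The upper bound, for an arbitrary covariance and with possibly infinite right-hand side. -/
theorem Represents.ofReal_norm_sq_le {T : ℝ} {K : Matrix (Icc (0 : ℝ) T) (Icc (0 : ℝ) T) ℝ}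
    {hK : K.PosSemidef} {o e : Icc (0 : ℝ) T} (ho : (o : ℝ) = 0) (he : (e : ℝ) = T)
    {f : Icc (0 : ℝ) T → ℝ} {h : WienerSpace K hK} (hh : Represents o e f h) {t : Icc (0 : ℝ) T}
    (hft : ∀ s, t < s → f s = 0) {ρ q p : ℝ} (hρ : 1 ≤ ρ) (hq : q = (1 / (2 * ρ) + 1 / 2)⁻¹)
    (hp : 0 < p) (hpq : 1 < 1 / p + 1 / q) (hV : mixedVar 1 ρ K o t o t ≠ ∞) :
    ENNReal.ofReal (‖h‖ ^ 2) ≤ ENNReal.ofReal (1 + youngConst (1 / p + 1 / q) ^ 2) *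
      mixedVar 1 ρ K o t o t * (pVar p f o e ^ 2 + supNorm f ^ 2) := by
  have hρ0 : 0 < ρ := by linarith
  have hKV := mixedVariationLE_of_ne_top hρ0 hV
  set V := mixedVar 1 ρ K o t o t with hVdef
  set C := youngConst (1 / p + 1 / q) with hC
  have hc : 0 < 1 + C ^ 2 := by positivity
  rcases eq_or_ne V 0 with hV0 | hV0
  · rw [hV0, ENNReal.toReal_zero] at hKV
    rw [hh.norm_eq_zero ho he hft hρ0 hKV]
    simp
  have hcV : ENNReal.ofReal (1 + C ^ 2) * V ≠ 0 :=
    mul_ne_zero (ENNReal.ofReal_pos.2 hc).ne' hV0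
  rcases eq_or_ne (pVar p f o e) ∞ with hpv | hpv
  · rw [hpv]; simp [ENNReal.mul_top hcV]
  rcases eq_or_ne (supNorm f) ∞ with hsn | hsn
  · rw [hsn]; simp [ENNReal.mul_top hcV]
  set A := (pVar p f o e).toReal with hA
  set M := (supNorm f).toReal with hM
  have hte : t ≤ e := Subtype.coe_le_coe.1 (by rw [he]; exact t.2.2)
  have h1 := hh.norm_le_of_variationLE ho he hft hρ hq hp hpq ENNReal.toReal_nonneg hKV
    ENNReal.toReal_nonneg ((variationLE_of_pVar_ne_top hp hpv).mono_set (Icc_subset_Icc_right hte))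
    (abs_le_toReal_supNorm hsn)
  have h2 : ‖h‖ ^ 2 ≤ (1 + C ^ 2) * V.toReal * (A ^ 2 + M ^ 2) := by
    calc ‖h‖ ^ 2 ≤ ((M + C * A) * √V.toReal) ^ 2 := pow_le_pow_left₀ (norm_nonneg _) h1 2
      _ = (M + C * A) ^ 2 * V.toReal := by rw [mul_pow, Real.sq_sqrt ENNReal.toReal_nonneg]
      _ ≤ ((1 + C ^ 2) * (A ^ 2 + M ^ 2)) * V.toReal := by
          refine mul_le_mul_of_nonneg_right ?_ ENNReal.toReal_nonneg
          nlinarith [sq_nonneg (A - C * M)]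
      _ = _ := by ring
  refine (ENNReal.ofReal_le_ofReal h2).trans_eq ?_
  rw [ENNReal.ofReal_mul (by positivity), ENNReal.ofReal_mul hc.le, ENNReal.ofReal_toReal hV,
    ENNReal.ofReal_add (sq_nonneg A) (sq_nonneg M), ENNReal.ofReal_pow ENNReal.toReal_nonneg,
    ENNReal.ofReal_pow ENNReal.toReal_nonneg, ENNReal.ofReal_toReal hpv, ENNReal.ofReal_toReal hsn]

theorem proposition2p9 (ρ : ℝ) (hρ1 : 1 ≤ ρ) (hρ2 : ρ < 2)
    (q : ℝ) (hq : q = (1 / (2 * ρ) + 1 / 2)⁻¹)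
    (p : ℝ) (hp : 1 ≤ p) (hpq : 1 < 1 / p + 1 / q) :
    ∃ c : ℝ, 0 < c ∧
      ∀ {Ω : Type*} [MeasurableSpace Ω] (P : Measure Ω) [IsProbabilityMeasure P]
        {d : ℕ} (T : ℝ) (_ : 0 < T)
        (o e : Icc (0 : ℝ) T) (_ : (o : ℝ) = 0) (_ : (e : ℝ) = T)
        (X : Icc (0 : ℝ) T → Ω → Fin d → ℝ)
        (hX : IsCenteredGaussianIID X P) (_ : ∀ᵐ ω ∂P, X o ω = 0) (j : Fin d)
        (_ : mixedVar 1 ρ (covKernel X P j) o e o e ≠ ∞),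
        -- upper bound
        (∀ (f : Icc (0 : ℝ) T → ℝ) (t : Icc (0 : ℝ) T), 0 < (t : ℝ) →
          (pVar p ((Icc o t).indicator f) o e ≠ ∞ →
            ∃ h : WienerSpace (covKernel X P j) (hX.posSemidef j),
              Represents o e ((Icc o t).indicator f) h) ∧
          ∀ h : WienerSpace (covKernel X P j) (hX.posSemidef j),
            Represents o e ((Icc o t).indicator f) h →
            ENNReal.ofReal (‖h‖ ^ 2) ≤
              ENNReal.ofReal c * mixedVar 1 ρ (covKernel X P j) o t o t *
                (pVar p ((Icc o t).indicator f) o e ^ 2 +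
                  supNorm ((Icc o t).indicator f) ^ 2)) ∧
        -- lower bound
        (NonposCorrelated (covKernel X P j) → DiagDominant (covKernel X P j) →
          ∀ (γ : ℝ≥0), 1 < 1 / ρ + (γ : ℝ) → ∀ f : Icc (0 : ℝ) T → ℝ, MemHolder γ f →
            ∀ t : Icc (0 : ℝ) T, 0 < (t : ℝ) →
              ∃ (h : WienerSpace (covKernel X P j) (hX.posSemidef j))
                (ν : Measure (Icc (0 : ℝ) T)),
                Represents o e ((Icc o t).indicator f) h ∧
                IsIncrMeasure (covKernel X P j) o t ν ∧
                ∫ r in Icc o t, f r ^ 2 ∂ν ≤ ‖h‖ ^ 2 ∧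
                sigmaSq X P j t * sInf ((fun r => |f r| ^ 2) '' Icc o t) ≤
                  ∫ r in Icc o t, f r ^ 2 ∂ν) := by
  refine ⟨1 + youngConst (1 / p + 1 / q) ^ 2, by positivity, ?_⟩
  intro Ω _ P _ d T hT o e ho he X hX hX0 j hfin
  have hρ0 : 0 < ρ := by linarith
  have hcont := hX.continuous_ind j
  have hbot : ∀ s : Icc (0 : ℝ) T, o ≤ s := fun s => Subtype.coe_le_coe.1 (by rw [ho]; exact s.2.1)
  have htop : ∀ s : Icc (0 : ℝ) T, s ≤ e := fun s => Subtype.coe_le_coe.1 (by rw [he]; exact s.2.2)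
  have hKV := mixedVariationLE_of_ne_top hρ0 hfin
  refine ⟨fun f t _ => ⟨fun hpv => ?_, fun h hh => ?_⟩, fun hneg hdd γ hγ f hf t _ => ?_⟩
  · exact exists_represents ho he hcont hρ1 hq hp hpq ENNReal.toReal_nonneg hKV
      ENNReal.toReal_nonneg (variationLE_of_pVar_ne_top (by linarith) hpv)
  · refine hh.ofReal_norm_sq_le ho he
      (fun s hs => indicator_of_notMem (fun h => absurd h.2 (not_le.2 hs)) f) hρ1 hq (by linarith)
      hpq ?_
    exact ne_top_of_le_ne_top hfin (mixedVar_mono zero_le_one hρ0.le _ (htop t))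
  · -- the Hölder exponent may be lowered to `g ≤ 1`, so that `1 / g ≥ 1` is a variation exponent
    set g : ℝ≥0 := min γ 1 with hg
    have hρinv : 1 / ρ ≤ 1 := by rw [div_le_one hρ0]; exact hρ1
    have hγ0 : 0 < γ := by
      have : (0 : ℝ) < γ := by linarith
      exact_mod_cast this
    have hg0 : 0 < g := lt_min hγ0 one_pos
    have hg1 : g ≤ 1 := min_le_right _ _
    have hgρ : 1 < 1 / ρ + (g : ℝ) := by
      rw [hg, NNReal.coe_min]
      rcases min_cases (γ : ℝ) ((1 : ℝ≥0) : ℝ) with ⟨h, _⟩ | ⟨h, _⟩ <;> rw [h]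
      · exact hγ
      · have : 0 < 1 / ρ := by positivity
        push_cast; linarith
    obtain ⟨C, hC⟩ := hf.of_le (s := g) (min_le_left _ _)
    have hfc : Continuous f := hC.continuous hg0
    have hg0' : (0 : ℝ) < g := hg0
    have hp1 : 1 ≤ 1 / (g : ℝ) := by
      rw [le_div_iff₀ hg0', one_mul]; exact_mod_cast hg1
    have hpq' : 1 < 1 / (1 / (g : ℝ)) + 1 / q := by
      have h1 : 1 / q = 1 / ρ / 2 + 1 / 2 := by rw [hq, one_div, inv_inv]; field_simp
      rw [one_div_one_div, h1]; linarith
    have hvar := ((HolderWith.variationLE hT.le hg0 hC).indicator_Icc hp1 (by positivity) hbot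
      t).mono_set (subset_univ (Icc o e))
    obtain ⟨h, hh⟩ := exists_represents (hK := hX.posSemidef j) ho he hcont hρ1 hq hp1 hpq'
      ENNReal.toReal_nonneg hKV (by positivity) hvar
    obtain ⟨ν, hν⟩ := exists_isIncrMeasure hcont ho hdd t
    refine ⟨h, ν, hh, hν, hh.setIntegral_sq_le hcont ho he hneg hν hfc, ?_⟩
    rw [← hX.rectIncr_eq_sigmaSq j hX0]
    exact hν.mul_sInf_le (hbot t) hfc
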